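/- For $\sigma>0$ and $z_k=x_k+\mathrm{i}y_k\in\mathbb{C}$ let $$K^{\sigma}_{\sin}(z_1,z_2)=\frac{1}{\sigma\sqrt{\pi}}\exp\Big[-\frac{y_1^2+y_2^2}{2\sigma^2}\Big]\frac{1}{2\pi}\int_{-\pi}^{\pi}\mathrm{e}^{-(\sigma u)^2}\cos\big(u(z_1-\overline{z_2})\big)\,\mathrm{d}u,$$ and let $K_{\sin}(x,y)=\frac{\sin\pi(x-y)}{\pi(x-y)}$ for $x,y\in\mathbb{R}$, with $K_{\sin}(x,x)=1$. For $t,\sigma>0$ let $$G_{\sigma}(t)=1+\sum_{\ell=1}^{\infty}\frac{(-1)^{\ell}}{\ell!}\int_{(J_t)^{\ell}}\det\big[K^{\sigma}_{\sin}(z_j,z_k)\big]_{j,k=1}^{\ell}\,\mathrm{d}^2z_1\cdots\mathrm{d}^2z_{\ell},\qquad J_t=(-t,t)\times\mathbb{R}\subset\mathbb{R}^2\simeq\mathbb{C}.$$ For $u>0$ put $\Omega_u=(0,u)\times\mathbb{R}\subset\mathbb{C}$, and let $\omega_j(K^{\sigma}_{\sin},\Omega_u)$ and $\omega_j(K_{\sin},(0,u))$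 be the non-zero eigenvalues, counted with algebraic multiplicity, of the integral operators on the complex spaces $L^2(\Omega_u)$ and $L^2(0,u)$ with kernels $K^{\sigma}_{\sin}$ and $K_{\sin}$. For $s>0$ let $$\wp(s,\sigma)=\int_0^s\frac{\mathrm{d}^2}{\mathrm{d}u^2}\prod_{j}\big(1-\omega_j(K^{\sigma}_{\sin},\Omega_u)\big)\,\mathrm{d}u,\qquad F_1(s)=\int_0^s\frac{\mathrm{d}^2}{\mathrm{d}u^2}\prod_{j}\big(1-\omega_j(K_{\sin},(0,u))\big)\,\mathrm{d}u;$$ $\wp(\cdot,\sigma)$ is the generalized Gaudin–Mehta spacing distribution function and $F_1$ is the Gaudin–Mehta distribution function. Then all these objects are well defined: for all $t,u,\sigma>0$ the determinants above and $\det[K_{\sin}(x_j,x_k)]_{j,k=1}^{\ell}$ are integrable over $(J_t)^{\ell}$ and $(-t,t)^{\ell}$ respectively; the series for $G_\sigma(t)$ and the series on the right of (1) converge absolutely; the non-zero eigenvalues have finite multiplicities and, counted with them, are absolutely summable; and for each $\sigma>0$ the two products are twice continuously differentiable functions of $u\in(0,\infty)$ whose second derivatives are integrable on $(0,s)$ for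 every $s>0$. Moreover, for every fixed $t>0$, $$\lim_{\sigma\downarrow0}G_{\sigma}(t)=1+\sum_{\ell=1}^{\infty}\frac{(-1)^{\ell}}{\ell!}\int_{(-t,t)^{\ell}}\det\left[\frac{\sin\pi(x_j-x_k)}{\pi(x_j-x_k)}\right]_{j,k=1}^{\ell}\mathrm{d}x_1\cdots\mathrm{d}x_{\ell},\tag{1}$$ and, for every fixed $s>0$, $$\lim_{\sigma\downarrow0}\wp(s,\sigma)=F_1(s).$$ -/

import Mathlib

open MeasureTheory Set Filter Topology

namespace SineGap

noncomputable section

/-! ### Fredholm series of a kernel -/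

section Fredholm

variable {X : Type*} [MeasureSpace X]

/-- The correlation determinant `det [K (x j) (x k)]`, `j, k = 1, …, ℓ`. -/
def corrDet (K : X → X → ℂ) (ℓ : ℕ) (x : Fin ℓ → X) : ℂ :=
  Matrix.det (Matrix.of fun j k : Fin ℓ => K (x j) (x k))

/-- The `ℓ`-th term `(-1)^ℓ / ℓ! ∫_{Ω^ℓ} det [K (x j) (x k)] dx₁ ⋯ dx_ℓ` of the Fredholm series. -/
def fredholmTerm (K : X → X → ℂ) (Ω : Set X) (ℓ : ℕ) : ℂ :=
  (-1) ^ ℓ / (Nat.factorial ℓ : ℂ) *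
    ∫ x in Set.pi univ (fun _ : Fin ℓ => Ω), corrDet K ℓ x

/-- `1 + ∑_{ℓ ≥ 1} (-1)^ℓ / ℓ! ∫_{Ω^ℓ} det [K (x j) (x k)] dx₁ ⋯ dx_ℓ`. -/
def fredholmSeries (K : X → X → ℂ) (Ω : Set X) : ℂ :=
  1 + ∑' ℓ : ℕ, fredholmTerm K Ω (ℓ + 1)

/-- All integrals in the Fredholm series exist, and the series converges absolutely. -/
def FredholmConverges (K : X → X → ℂ) (Ω : Set X) : Prop :=
  (∀ ℓ : ℕ, IntegrableOn (corrDet K ℓ) (Set.pi univ (fun _ : Fin ℓ => Ω))) ∧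
    Summable (fun ℓ : ℕ => ‖fredholmTerm K Ω (ℓ + 1)‖)

end Fredholm

/-! ### Square-integrable kernels, their integral operators, and products over eigenvalues -/

section Operator

variable {X : Type*} [MeasureSpace X]

/-- The kernel `K` is square-integrable on `Ω × Ω`. -/
def SqIntegrableKernel (K : X → X → ℂ) (Ω : Set X) : Prop :=
  MemLp (fun p : X × X => K p.1 p.2) 2
    ((volume.restrict Ω).prod (volume.restrict Ω))

variable [SFinite (volume : Measure X)] {K : X → X → ℂ} {Ω : Set X}

theorem SqIntegrableKernel.ae_memLp (hK : SqIntegrableKernel K Ω) :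
    ∀ᵐ x ∂(volume.restrict Ω), MemLp (fun y => K x y) 2 (volume.restrict Ω) := by
  have h1 := (memLp_two_iff_integrable_sq_norm hK.1).1 hK
  filter_upwards [h1.prod_right_ae, hK.1.prodMk_left] with x hx hm
  exact (memLp_two_iff_integrable_sq_norm hm).2 hx

theorem SqIntegrableKernel.ae_integrable (hK : SqIntegrableKernel K Ω)
    (f : Lp ℂ 2 (volume.restrict Ω)) :
    ∀ᵐ x ∂(volume.restrict Ω), Integrable (fun y => K x y * f y) (volume.restrict Ω) := by
  filter_upwards [hK.ae_memLp] with x hx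
  exact hx.integrable_mul (Lp.memLp f)

theorem SqIntegrableKernel.memLp_integral (hK : SqIntegrableKernel K Ω)
    (f : Lp ℂ 2 (volume.restrict Ω)) :
    MemLp (fun x => ∫ y in Ω, K x y * f y) 2 (volume.restrict Ω) := by
  have hm : AEStronglyMeasurable (fun x => ∫ y in Ω, K x y * f y) (volume.restrict Ω) := by
    have : AEStronglyMeasurable (fun p : X × X => K p.1 p.2 * f p.2)
        ((volume.restrict Ω).prod (volume.restrict Ω)) :=
      hK.1.mul (Lp.aestronglyMeasurable f).comp_snd
    exact this.integral_prod_right'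
  have h1 := (memLp_two_iff_integrable_sq_norm hK.1).1 hK
  have hf := (memLp_two_iff_integrable_sq_norm (Lp.aestronglyMeasurable f)).1 (Lp.memLp f)
  rw [memLp_two_iff_integrable_sq_norm hm]
  refine (h1.integral_prod_left.mul_const (∫ y in Ω, ‖f y‖ ^ 2)).mono' (hm.norm.pow 2) ?_
  filter_upwards [hK.ae_memLp] with x hx
  rw [Real.norm_of_nonneg (by positivity)]
  have h2 : ‖∫ y in Ω, K x y * f y‖ ≤ ∫ y in Ω, ‖K x y‖ * ‖f y‖ := by
    refine (norm_integral_le_integral_norm _).trans (le_of_eq ?_)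
    simp
  have h3 := integral_mul_le_Lp_mul_Lq_of_nonneg (μ := volume.restrict Ω)
    (Real.HolderConjugate.two_two) (f := fun y => ‖K x y‖) (g := fun y => ‖f y‖)
    (Eventually.of_forall fun _ => norm_nonneg _) (Eventually.of_forall fun _ => norm_nonneg _)
    (by simpa using hx.norm) (by simpa using (Lp.memLp f).norm)
  have h4 := pow_le_pow_left₀ (norm_nonneg _) (h2.trans h3) 2
  refine h4.trans (le_of_eq ?_)
  have e : ∀ a : ℝ, 0 ≤ a → (a ^ (1 / (2 : ℝ))) ^ 2 = a := fun a ha => by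
    rw [← Real.sqrt_eq_rpow, Real.sq_sqrt ha]
  simp only [Real.rpow_two]
  rw [mul_pow, e _ (integral_nonneg fun _ => by positivity),
    e _ (integral_nonneg fun _ => by positivity)]

/-- The integral operator `(K f)(x) = ∫_Ω K(x, y) f(y) dy` on the complex space `L²(Ω)`. -/
def integralOp (K : X → X → ℂ) (Ω : Set X) (hK : SqIntegrableKernel K Ω) :
    Module.End ℂ (Lp ℂ 2 ((volume : Measure X).restrict Ω)) where
  toFun f := (hK.memLp_integral f).toLp (fun x => ∫ y in Ω, K x y * f y)
  map_add' f g := by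
    rw [← MemLp.toLp_add]
    refine MemLp.toLp_congr _ _ ?_
    filter_upwards [hK.ae_integrable f, hK.ae_integrable g] with x hf hg
    rw [Pi.add_apply, ← integral_add hf hg]
    refine integral_congr_ae ?_
    filter_upwards [Lp.coeFn_add f g] with y hy
    rw [hy, Pi.add_apply, mul_add]
  map_smul' c f := by
    rw [RingHom.id_apply, ← MemLp.toLp_const_smul]
    refine MemLp.toLp_congr _ _ (Eventually.of_forall fun x => ?_)
    simp only [Pi.smul_apply, smul_eq_mul]
    rw [← integral_const_mul]
    refine integral_congr_ae ?_
    filter_upwards [Lp.coeFn_smul c f] with y hy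
    rw [hy, Pi.smul_apply, smul_eq_mul]
    ring

end Operator

section Eigenvalues

variable {V : Type*} [AddCommGroup V] [Module ℂ V]

/-- The non-zero eigenvalues of `T`. -/
abbrev NonzeroEigenvalue (T : Module.End ℂ V) : Type :=
  {ω : ℂ // ω ≠ 0 ∧ T.HasEigenvalue ω}

/-- Algebraic multiplicity: the dimension of the generalized eigenspace `⋃ₙ ker (T - ω)ⁿ`. -/
def algMult (T : Module.End ℂ V) (ω : ℂ) : ℕ :=
  Module.finrank ℂ (T.maxGenEigenspace ω)

/-- `∏ⱼ (1 - ωⱼ)` over the non-zero eigenvalues of `T`, counted with algebraic multiplicity. -/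
def eigenProd (T : Module.End ℂ V) : ℂ :=
  ∏' ω : NonzeroEigenvalue T, (1 - (ω : ℂ)) ^ algMult T ω

/-- The non-zero eigenvalues of `T` have finite algebraic multiplicities and, counted with them,
are absolutely summable. -/
def EigenSummable (T : Module.End ℂ V) : Prop :=
  (∀ ω : NonzeroEigenvalue T, FiniteDimensional ℂ (T.maxGenEigenspace (ω : ℂ))) ∧
    Summable (fun ω : NonzeroEigenvalue T => (algMult T ω : ℝ) * ‖(ω : ℂ)‖)

end Eigenvalues

/-! ### The two kernels -/

/-- The sine kernel `sin π(x-y) / (π(x-y))`, with value `1` for `x = y`. -/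
def sineKernel (x y : ℝ) : ℂ :=
  ((Real.sinc (Real.pi * (x - y)) : ℝ) : ℂ)

/-- The kernel `(σ√π)⁻¹ exp(-(y₁² + y₂²)/(2σ²)) (2π)⁻¹ ∫_{-π}^{π} exp(-(σu)²) cos(u(z₁ - z̄₂)) du`,
where `y₁ = Im z₁` and `y₂ = Im z₂`. -/
def weakKernel (σ : ℝ) (z₁ z₂ : ℂ) : ℂ :=
  ((1 / (σ * Real.sqrt Real.pi) *
      Real.exp (-((z₁.im ^ 2 + z₂.im ^ 2) / (2 * σ ^ 2))) : ℝ) : ℂ) *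
    (1 / (2 * (Real.pi : ℂ)) *
      ∫ u in (-Real.pi)..Real.pi,
        ((Real.exp (-(σ * u) ^ 2) : ℝ) : ℂ) *
          Complex.cos ((u : ℂ) * (z₁ - (starRingEnd ℂ) z₂)))

/-- The vertical strip `(a, b) × ℝ ⊆ ℂ`. -/
def strip (a b : ℝ) : Set ℂ := {z : ℂ | z.re ∈ Ioo a b}

theorem measurableSet_strip (a b : ℝ) : MeasurableSet (strip a b) :=
  Complex.measurable_re measurableSet_Ioo

theorem sqIntegrable_sineKernel (a b : ℝ) : SqIntegrableKernel sineKernel (Ioo a b) := by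
  have hc : Continuous (fun p : ℝ × ℝ => sineKernel p.1 p.2) := by
    unfold sineKernel
    exact Complex.continuous_ofReal.comp (Real.continuous_sinc.comp (by fun_prop))
  refine MemLp.of_bound hc.aestronglyMeasurable 1 (Eventually.of_forall fun p => ?_)
  simp only [sineKernel, Complex.norm_real, Real.norm_eq_abs]
  exact Real.abs_sinc_le_one _

theorem continuous_weakKernel (σ : ℝ) :
    Continuous (fun p : ℂ × ℂ => weakKernel σ p.1 p.2) := by
  unfold weakKernel
  refine Continuous.mul (by fun_prop) (continuous_const.mul ?_)
  exact intervalIntegral.continuous_parametric_intervalIntegral_of_continuous'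
    (f := fun (p : ℂ × ℂ) (u : ℝ) => ((Real.exp (-(σ * u) ^ 2) : ℝ) : ℂ) *
          Complex.cos ((u : ℂ) * (p.1 - (starRingEnd ℂ) p.2))) (by fun_prop) _ _

theorem norm_cos_le_exp (w : ℂ) : ‖Complex.cos w‖ ≤ Real.exp |w.im| := by
  rw [Complex.cos, norm_div]
  have h1 : ‖Complex.exp (w * Complex.I)‖ ≤ Real.exp |w.im| := by
    rw [Complex.norm_exp]; simpa using neg_le_abs _
  have h2 : ‖Complex.exp (-w * Complex.I)‖ ≤ Real.exp |w.im| := by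
    rw [Complex.norm_exp]; simpa using le_abs_self _
  have h3 := norm_add_le (Complex.exp (w * Complex.I)) (Complex.exp (-w * Complex.I))
  simp only [Complex.norm_ofNat]
  linarith

theorem norm_weakKernel_le {σ : ℝ} (hσ : σ ≠ 0) (z₁ z₂ : ℂ) :
    ‖weakKernel σ z₁ z₂‖ ≤ |1 / (σ * Real.sqrt Real.pi)| * Real.exp (2 * (Real.pi * σ) ^ 2) *
      (Real.exp (-(1 / (4 * σ ^ 2)) * z₁.im ^ 2) * Real.exp (-(1 / (4 * σ ^ 2)) * z₂.im ^ 2)) := by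
  have hpi := Real.pi_pos
  have key : ∀ y : ℝ, Real.pi * |y| ≤ y ^ 2 / (4 * σ ^ 2) + (Real.pi * σ) ^ 2 := fun y => by
    have hs : 0 < |σ| := abs_pos.2 hσ
    have h := sq_nonneg (|y| / (2 * |σ|) - Real.pi * |σ|)
    have e : (|y| / (2 * |σ|) - Real.pi * |σ|) ^ 2
        = y ^ 2 / (4 * σ ^ 2) + (Real.pi * σ) ^ 2 - Real.pi * |y| := by
      rw [← sq_abs y, ← sq_abs σ, mul_pow, ← sq_abs σ]
      field_simp
      ring
    linarith
  have hint : ‖∫ u in (-Real.pi)..Real.pi, ((Real.exp (-(σ * u) ^ 2) : ℝ) : ℂ) *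
      Complex.cos ((u : ℂ) * (z₁ - (starRingEnd ℂ) z₂))‖
      ≤ Real.exp (Real.pi * |z₁.im| + Real.pi * |z₂.im|) * |Real.pi - -Real.pi| := by
    refine intervalIntegral.norm_integral_le_of_norm_le_const fun u hu => ?_
    rw [uIoc_of_le (by linarith)] at hu
    have hu' : |u| ≤ Real.pi := abs_le.2 ⟨hu.1.le, hu.2⟩
    rw [norm_mul, Complex.norm_real, Real.norm_eq_abs, abs_of_pos (Real.exp_pos _)]
    have h1 : Real.exp (-(σ * u) ^ 2) ≤ 1 := Real.exp_le_one_iff.2 (by nlinarith [sq_nonneg (σ * u)])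
    have h2 := norm_cos_le_exp ((u : ℂ) * (z₁ - (starRingEnd ℂ) z₂))
    have h3 : |((u : ℂ) * (z₁ - (starRingEnd ℂ) z₂)).im| ≤
        Real.pi * |z₁.im| + Real.pi * |z₂.im| := by
      have : ((u : ℂ) * (z₁ - (starRingEnd ℂ) z₂)).im = u * (z₁.im + z₂.im) := by simp
      rw [this, abs_mul, ← mul_add]
      exact mul_le_mul hu' (abs_add_le _ _) (abs_nonneg _) hpi.le
    calc _ ≤ 1 * Real.exp |((u : ℂ) * (z₁ - (starRingEnd ℂ) z₂)).im| :=
          mul_le_mul h1 h2 (norm_nonneg _) zero_le_one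
      _ ≤ _ := by rw [one_mul]; exact Real.exp_le_exp.2 h3
  have hpre : ‖(1 / (2 * (Real.pi : ℂ)))‖ = 1 / (2 * Real.pi) := by
    simp [abs_of_pos hpi]
  have habs : |Real.pi - -Real.pi| = 2 * Real.pi := by
    rw [abs_of_pos (by linarith)]; ring
  rw [habs] at hint
  unfold weakKernel
  rw [norm_mul, norm_mul, hpre, Complex.norm_real, Real.norm_eq_abs, abs_mul,
    abs_of_pos (Real.exp_pos _), mul_assoc, mul_assoc]
  refine mul_le_mul_of_nonneg_left ?_ (abs_nonneg _)
  calc _ ≤ Real.exp (-((z₁.im ^ 2 + z₂.im ^ 2) / (2 * σ ^ 2))) *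
        (1 / (2 * Real.pi) *
          (Real.exp (Real.pi * |z₁.im| + Real.pi * |z₂.im|) * (2 * Real.pi))) := by gcongr
    _ = Real.exp (-((z₁.im ^ 2 + z₂.im ^ 2) / (2 * σ ^ 2)) +
          (Real.pi * |z₁.im| + Real.pi * |z₂.im|)) := by
        have : 1 / (2 * Real.pi) *
            (Real.exp (Real.pi * |z₁.im| + Real.pi * |z₂.im|) * (2 * Real.pi)) =
            Real.exp (Real.pi * |z₁.im| + Real.pi * |z₂.im|) := by
          generalize Real.exp (Real.pi * |z₁.im| + Real.pi * |z₂.im|) = E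
          field_simp
        rw [this, ← Real.exp_add]
    _ ≤ Real.exp (2 * (Real.pi * σ) ^ 2 + (-(1 / (4 * σ ^ 2)) * z₁.im ^ 2 +
          -(1 / (4 * σ ^ 2)) * z₂.im ^ 2)) := by
        refine Real.exp_le_exp.2 ?_
        have e : (z₁.im ^ 2 + z₂.im ^ 2) / (2 * σ ^ 2) =
            2 * (z₁.im ^ 2 / (4 * σ ^ 2)) + 2 * (z₂.im ^ 2 / (4 * σ ^ 2)) := by
          field_simp; ring
        have e1 : ∀ y : ℝ, -(1 / (4 * σ ^ 2)) * y ^ 2 = -(y ^ 2 / (4 * σ ^ 2)) := fun y => by ring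
        rw [e, e1, e1]
        linarith [key z₁.im, key z₂.im]
    _ = _ := by rw [Real.exp_add, Real.exp_add]

theorem integrable_gauss_strip {c : ℝ} (hc : 0 < c) (a b : ℝ) :
    Integrable (fun z : ℂ => Real.exp (-c * z.im ^ 2)) (volume.restrict (strip a b)) := by
  have h : IntegrableOn (fun p : ℝ × ℝ => Real.exp (-c * p.2 ^ 2)) (Ioo a b ×ˢ univ) := by
    rw [IntegrableOn, Measure.volume_eq_prod, ← Measure.prod_restrict, Measure.restrict_univ]
    exact (integrable_exp_neg_mul_sq hc).comp_snd _
  have e : strip a b = Complex.measurableEquivRealProd ⁻¹' (Ioo a b ×ˢ univ) := by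
    ext z
    simp [strip, Complex.measurableEquivRealProd_apply]
  rw [e]
  exact (Complex.volume_preserving_equiv_real_prod.integrableOn_comp_preimage
    Complex.measurableEquivRealProd.measurableEmbedding).2 h

theorem sqIntegrable_weakKernel (σ a b : ℝ) :
    SqIntegrableKernel (weakKernel σ) (strip a b) := by
  by_cases hσ : σ = 0
  · have : (fun p : ℂ × ℂ => weakKernel σ p.1 p.2) = 0 := by
      funext p; simp [weakKernel, hσ]
    rw [SqIntegrableKernel, this]
    exact MemLp.zero
  have hc : (0 : ℝ) < 1 / (2 * σ ^ 2) := by positivity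
  have hint := integrable_gauss_strip hc a b
  refine (memLp_two_iff_integrable_sq_norm (continuous_weakKernel σ).aestronglyMeasurable).2 ?_
  refine ((hint.mul_prod hint).const_mul
    ((|1 / (σ * Real.sqrt Real.pi)| * Real.exp (2 * (Real.pi * σ) ^ 2)) ^ 2)).mono'
    ((continuous_weakKernel σ).norm.pow 2).aestronglyMeasurable
    (Eventually.of_forall fun p => ?_)
  rw [Real.norm_of_nonneg (by positivity)]
  refine (pow_le_pow_left₀ (norm_nonneg _) (norm_weakKernel_le hσ p.1 p.2) 2).trans (le_of_eq ?_)
  have e : ∀ y : ℝ, Real.exp (-(1 / (4 * σ ^ 2)) * y ^ 2) ^ 2 =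
      Real.exp (-(1 / (2 * σ ^ 2)) * y ^ 2) := fun y => by
    rw [← Real.exp_nat_mul]; congr 1; push_cast; field_simp; ring
  rw [mul_pow, mul_pow (Real.exp _), e, e]

/-! ### The determinants and the spacing distributions -/

/-- The integral operator with kernel `weakKernel σ` on `L²(Ω_u)`, `Ω_u = (0, u) × ℝ`. -/
def weakOp (σ u : ℝ) : Module.End ℂ (Lp ℂ 2 ((volume : Measure ℂ).restrict (strip 0 u))) :=
  integralOp (weakKernel σ) (strip 0 u) (sqIntegrable_weakKernel σ 0 u)

/-- The integral operator with the sine kernel on `L²(0, u)`. -/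
def sineOp (u : ℝ) : Module.End ℂ (Lp ℂ 2 ((volume : Measure ℝ).restrict (Ioo 0 u))) :=
  integralOp sineKernel (Ioo 0 u) (sqIntegrable_sineKernel 0 u)

/-- `G_σ(t)`: the Fredholm series of `weakKernel σ` on the strip `(-t, t) × ℝ`. -/
def G (σ t : ℝ) : ℂ := fredholmSeries (weakKernel σ) (strip (-t) t)

/-- The spacing distribution `∫₀ˢ D''(u) du` that belongs to the gap function `D`. -/
def spacing (D : ℝ → ℂ) (s : ℝ) : ℂ := ∫ u in (0 : ℝ)..s, iteratedDeriv 2 D u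

/-- `℘(s, σ) = ∫₀ˢ d²/du² ∏ⱼ (1 - ωⱼ(K^σ, Ω_u)) du`. -/
def wp (s σ : ℝ) : ℂ := spacing (fun u => eigenProd (weakOp σ u)) s

/-- The Gaudin–Mehta distribution `F₁(s) = ∫₀ˢ d²/du² ∏ⱼ (1 - ωⱼ(K_sin, (0, u))) du`. -/
def gaudinMehta (s : ℝ) : ℂ := spacing (fun u => eigenProd (sineOp u)) s

/-- `D` is twice continuously differentiable on `(0, ∞)`, and `D''` is integrable on `(0, s)`
for every `s > 0`. -/
def SpacingWellDefined (D : ℝ → ℂ) : Prop :=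
  ContDiffOn ℝ 2 D (Ioi 0) ∧
    ∀ s : ℝ, 0 < s → IntervalIntegrable (iteratedDeriv 2 D) volume 0 s

end

end SineGap

/-! As σ ↓ 0 the weak kernel concentrates on the real axis and blows up, so no direct limit of
kernels is taken. Instead, both kernels are written as A A*, where A maps L²(-π, π) into L² of the
interval or strip, and the series is transferred to A* A. For the weak kernel A has the kernel
c·exp(-y²/(2σ²) - σ²v²/2)·exp(ivz). Integrating y out in A* A cancels every singular power of σ and
leaves exp(-σ²(v-w)²/4)·(2π)⁻¹∫exp(i(w-v)x)dx on (-π, π), which is `dualKernel`. Its value at σ = 0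
is the A* A of the sine kernel, so σ = 0 becomes an ordinary point.

Andréief's identity (`integral_det_eq_integral_det`) equates the series of A A* and A* A term by
term. Since A A* is compact and symmetric, its eigenvalue product is the same series: the product is
expanded on finite parts of an eigenbasis, and dominated convergence passes to the limit
(`hasProd_one_sub_eigenbasis`). `fredholm_factor` combines these facts.

The dual kernel is jointly continuous in (σ, t) and entire in the endpoint t. Hadamard's bound then
makes the dual series D_σ(t) jointly continuous and entire in t. This gives (1). It also gives
convergence of D_σ', and the spacing integral equals D_σ'(s) - D_σ'(0). -/

namespace SineGap

set_option linter.unusedSectionVars false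

/-! ### Hadamard's bound and the combinatorics of finite Fredholm expansions. -/

open Matrix in
open scoped ComplexOrder in
/-- A Hadamard-type bound for determinants with uniformly bounded entries. -/
theorem norm_det_le_of_norm_le {l : ℕ} (M : Matrix (Fin l) (Fin l) ℂ) {C : ℝ}
    (hC : ∀ i j, ‖M i j‖ ≤ C) : ‖M.det‖ ≤ (Real.sqrt l * C) ^ l := by
  rcases Nat.eq_zero_or_pos l with rfl | hl
  · simp
  have hl' : (0 : ℝ) < l := by exact_mod_cast hl
  have hC0 : 0 ≤ C := (norm_nonneg _).trans (hC ⟨0, hl⟩ ⟨0, hl⟩)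
  -- AM-GM is applied to the eigenvalues of M Mᴴ: their product is |det M|² and their sum is the
  -- squared Frobenius norm, at most l²C².
  have hP : (M * Mᴴ).PosSemidef := Matrix.posSemidef_self_mul_conjTranspose M
  have hdet : ‖M.det‖ ^ 2 = ∏ i, hP.1.eigenvalues i := by
    have h := hP.1.det_eq_prod_eigenvalues
    rw [Matrix.det_mul, Matrix.det_conjTranspose] at h
    have h2 : ((‖M.det‖ ^ 2 : ℝ) : ℂ) = M.det * star M.det := by
      rw [Complex.star_def, Complex.mul_conj, Complex.normSq_eq_norm_sq]
    have h3 := h2.trans h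
    simp only [Complex.coe_algebraMap, ← Complex.ofReal_prod] at h3
    exact_mod_cast h3
  have htr : ∑ i, hP.1.eigenvalues i ≤ l * (l * C ^ 2) := by
    have h := hP.1.trace_eq_sum_eigenvalues
    have h2 : (M * Mᴴ).trace = ((∑ i, ∑ j, ‖M i j‖ ^ 2 : ℝ) : ℂ) := by
      simp only [Matrix.trace, Matrix.diag_apply, Matrix.mul_apply, Matrix.conjTranspose_apply,
        Complex.star_def, Complex.mul_conj, Complex.normSq_eq_norm_sq]
      push_cast
      rfl
    rw [h2] at h
    have h3 : (∑ i, ∑ j, ‖M i j‖ ^ 2 : ℝ) = ∑ i, hP.1.eigenvalues i :=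
      Complex.ofReal_injective (h.trans (by simp))
    rw [← h3]
    calc (∑ i, ∑ j, ‖M i j‖ ^ 2 : ℝ) ≤ ∑ _i : Fin l, ∑ _j : Fin l, C ^ 2 := by
          gcongr with i _ j _
          exact hC i j
      _ = _ := by simp
  have ham := Real.geom_mean_le_arith_mean Finset.univ (fun _ => 1) hP.1.eigenvalues
    (fun _ _ => zero_le_one) (by simpa using hl) (fun i _ => hP.eigenvalues_nonneg i)
  simp only [Real.rpow_one, Finset.sum_const, Finset.card_univ, Fintype.card_fin, nsmul_eq_mul,
    mul_one, one_mul] at ham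
  rw [← hdet] at ham
  have h4 : (‖M.det‖ ^ 2) ^ (l : ℝ)⁻¹ ≤ l * C ^ 2 := by
    refine ham.trans ((div_le_iff₀ hl').2 (htr.trans_eq (by ring)))
  have h5 := pow_le_pow_left₀ (by positivity) h4 l
  rw [Real.rpow_inv_natCast_pow (by positivity) hl.ne'] at h5
  refine (pow_le_pow_iff_left₀ (norm_nonneg _) (by positivity) two_ne_zero).1 (h5.trans_eq ?_)
  rw [← pow_mul, mul_comm l 2, pow_mul, mul_pow (Real.sqrt l), Real.sq_sqrt hl'.le]

/-- Since l^l / l! ≤ e^l, the square of the term is at most (e x²)^l / l!. Inserting 4^l·4^(-l)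
splits this into a product ab of two summable sequences, and ab ≤ (a + b)². -/
theorem summable_sqrt_mul_pow_div_factorial (x : ℝ) :
    Summable fun l : ℕ => (Real.sqrt l * x) ^ l / (l.factorial : ℝ) := by
  have h1 := Real.summable_pow_div_factorial (Real.exp 1 * (4 * x ^ 2))
  have h2 : Summable fun l : ℕ => ((1 : ℝ) / 4) ^ l :=
    summable_geometric_of_lt_one (by norm_num) (by norm_num)
  refine (h1.add h2).of_norm_bounded fun l => ?_
  have hf : (0 : ℝ) < l.factorial := by positivity
  have key : ((Real.sqrt l * x) ^ l / (l.factorial : ℝ)) ^ 2 ≤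
      (Real.exp 1 * (4 * x ^ 2)) ^ l / l.factorial * (1 / 4) ^ l := by
    have h3 := Real.pow_div_factorial_le_exp (x := (l : ℝ)) (by positivity) l
    have h4 : ((Real.sqrt l * x) ^ l / (l.factorial : ℝ)) ^ 2 =
        (l : ℝ) ^ l / l.factorial * ((x ^ 2) ^ l / l.factorial) := by
      rw [div_pow, ← pow_mul, mul_comm l 2, pow_mul, mul_pow, Real.sq_sqrt (by positivity), mul_pow]
      field_simp
    have h5 : (Real.exp 1 * (4 * x ^ 2)) ^ l / l.factorial * (1 / 4) ^ l =
        Real.exp l * ((x ^ 2) ^ l / l.factorial) := by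
      rw [mul_pow, mul_pow, ← Real.exp_nat_mul, mul_one, one_div, inv_pow]
      field_simp
    rw [h4, h5]
    gcongr
  have ha : 0 ≤ (Real.exp 1 * (4 * x ^ 2)) ^ l / (l.factorial : ℝ) := by positivity
  have hb : (0 : ℝ) ≤ (1 / 4) ^ l := by positivity
  rw [Real.norm_eq_abs]
  refine abs_le_of_sq_le_sq (key.trans ?_) (by positivity)
  nlinarith

theorem det_of_ite_eq {ι : Type*} [DecidableEq ι] (c : ι → ℂ) {l : ℕ} (n : Fin l → ι) :
    Matrix.det (Matrix.of fun j k : Fin l => if n j = n k then c (n k) else 0) =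
      if Function.Injective n then ∏ j, c (n j) else 0 := by
  split_ifs with h
  · rw [← Matrix.det_diagonal]
    congr 1
    ext j k
    by_cases hjk : j = k
    · simp [hjk]
    · simp [hjk, h.ne hjk]
  · simp only [Function.Injective, not_forall] at h
    obtain ⟨j, k, hjk, hne⟩ := h
    exact Matrix.det_zero_of_row_eq hne (by ext m; simp [hjk])

theorem card_filter_injective_image_eq {ι : Type*} [Fintype ι] [DecidableEq ι] (s : Finset ι)
    {l : ℕ} (hs : s.card = l) :
    (Finset.univ.filter fun n : Fin l → ι =>
      Function.Injective n ∧ Finset.univ.image n = s).card = l.factorial := by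
  have h1 : Fintype.card (Fin l ≃ s) = l.factorial := by
    rw [Fintype.card_equiv (Fintype.equivOfCardEq (by simp [hs])), Fintype.card_fin]
  rw [← h1, ← Finset.card_univ]
  symm
  refine Finset.card_bij (fun e _ j => (e j : ι)) ?_ ?_ ?_
  · intro e _
    simp only [Finset.mem_filter, Finset.mem_univ, true_and]
    refine ⟨fun a b hab => e.injective (Subtype.ext hab), ?_⟩
    ext i
    simp only [Finset.mem_image, Finset.mem_univ, true_and]
    exact ⟨fun ⟨j, hj⟩ => hj ▸ (e j).2, fun hi => ⟨e.symm ⟨i, hi⟩, by simp⟩⟩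
  · intro e _ e' _ h
    ext j
    exact congr_fun h j
  · intro n hn
    simp only [Finset.mem_filter, Finset.mem_univ, true_and] at hn
    obtain ⟨hinj, him⟩ := hn
    have hmem : ∀ j, n j ∈ s := fun j => him ▸ Finset.mem_image_of_mem n (Finset.mem_univ j)
    refine ⟨Equiv.ofBijective (fun j => (⟨n j, hmem j⟩ : s)) ⟨fun a b hab => hinj ?_, ?_⟩,
      Finset.mem_univ _, rfl⟩
    · exact congr_arg Subtype.val hab
    · rintro ⟨i, hi⟩
      rw [← him] at hi
      obtain ⟨j, -, hj⟩ := Finset.mem_image.1 hi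
      exact ⟨j, Subtype.ext hj⟩

/-- Only injective tuples contribute, and each l-element set is the image of l! of them. This l!
cancels the 1/l! of the Fredholm series and leaves elementary symmetric functions. -/
theorem sum_det_of_ite_eq {ι : Type*} [Fintype ι] [DecidableEq ι] (c : ι → ℂ) (l : ℕ) :
    ∑ n : Fin l → ι, Matrix.det (Matrix.of fun j k : Fin l => if n j = n k then c (n k) else 0) =
      l.factorial * ∑ s ∈ (Finset.univ : Finset ι).powersetCard l, ∏ i ∈ s, c i := by
  simp only [det_of_ite_eq]
  rw [← Finset.sum_filter, ← Finset.sum_fiberwise_of_maps_to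
    (t := (Finset.univ : Finset ι).powersetCard l) (g := fun n => Finset.univ.image n)]
  · rw [Finset.mul_sum]
    refine Finset.sum_congr rfl fun s hs => ?_
    rw [← card_filter_injective_image_eq s (Finset.mem_powersetCard.1 hs).2, Finset.filter_filter,
      ← nsmul_eq_mul, ← Finset.sum_const]
    refine Finset.sum_congr rfl fun n hn => ?_
    obtain ⟨-, hinj, him⟩ := Finset.mem_filter.1 hn
    rw [← him, Finset.prod_image fun a _ b _ h => hinj h]
  · intro n hn
    rw [Finset.mem_powersetCard]
    refine ⟨Finset.subset_univ _, ?_⟩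
    rw [Finset.card_image_of_injective _ (Finset.mem_filter.1 hn).2]
    simp

/-- The Fredholm expansion of a finite product. -/
theorem hasSum_prod_one_sub {ι : Type*} [Fintype ι] (c : ι → ℂ) :
    HasSum (fun l : ℕ => (-1 : ℂ) ^ l * ∑ s ∈ (Finset.univ : Finset ι).powersetCard l, ∏ i ∈ s, c i)
      (∏ i, (1 - c i)) := by
  classical
  have h : ∏ i, (1 - c i) = ∑ l ∈ Finset.range (Fintype.card ι + 1),
      (-1 : ℂ) ^ l * ∑ s ∈ (Finset.univ : Finset ι).powersetCard l, ∏ i ∈ s, c i := by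
    simp only [sub_eq_add_neg]
    rw [Finset.prod_one_add, Finset.sum_powerset, Finset.card_univ]
    refine Finset.sum_congr rfl fun l _ => ?_
    rw [Finset.mul_sum]
    refine Finset.sum_congr rfl fun s hs => ?_
    rw [Finset.prod_neg, (Finset.mem_powersetCard.1 hs).2]
  rw [h]
  refine hasSum_sum_of_ne_finset_zero fun l hl => ?_
  rw [Finset.powersetCard_eq_empty.2 (by simpa using hl)]
  simp

/-! ### Andréief's identity. -/

section Andreief

open scoped ComplexConjugate

variable {X Y : Type*} [MeasurableSpace X] [MeasurableSpace Y] {μ : Measure X} [SigmaFinite μ]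
  {ν : Measure Y} [IsFiniteMeasure ν] {a : X → Y → ℂ} {g : X → ℝ}

theorem integrable_prod_sq (hg : MemLp g 2 μ) (l : ℕ) :
    Integrable (fun x : Fin l → X => ∏ j, g (x j) ^ 2) (Measure.pi fun _ => μ) :=
  Integrable.fintype_prod fun _ => hg.integrable_sq

/-- The domination behind Fubini: π only permutes the x-variables, so each g (x j) occurs exactly
twice and the bound ∏ g (x j)² does not depend on y. -/
theorem integrable_andreief (ha : Measurable (Function.uncurry a)) (hg : MemLp g 2 μ)
    (hag : ∀ x y, ‖a x y‖ ≤ g x) {l : ℕ} (π : Equiv.Perm (Fin l)) :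
    Integrable (fun p : (Fin l → X) × (Fin l → Y) =>
      ∏ j, (a (p.1 (π j)) (p.2 j) * conj (a (p.1 j) (p.2 j))))
      ((Measure.pi fun _ => μ).prod (Measure.pi fun _ => ν)) := by
  have hg' := (integrable_prod_sq hg l).comp_fst (Measure.pi fun _ : Fin l => ν)
  refine hg'.mono' ?_ (Eventually.of_forall fun p => ?_)
  · refine Measurable.aestronglyMeasurable ?_
    refine Finset.measurable_prod _ fun j _ => ?_
    have h : ∀ i : Fin l, Measurable fun p : (Fin l → X) × (Fin l → Y) => a (p.1 i) (p.2 j) :=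
      fun i => by
        have h2 : Measurable fun p : (Fin l → X) × (Fin l → Y) => (p.1 i, p.2 j) := by fun_prop
        exact ha.comp h2
    exact (h _).mul (Complex.continuous_conj.measurable.comp (h _))
  · simp only [Finset.prod_mul_distrib, norm_mul, norm_prod, RCLike.norm_conj, sq]
    have h0 : ∀ j, 0 ≤ g (p.1 j) := fun j => (norm_nonneg _).trans (hag (p.1 j) (p.2 j))
    refine mul_le_mul ?_ (Finset.prod_le_prod (fun _ _ => norm_nonneg _) fun j _ => hag _ _)
      (Finset.prod_nonneg fun _ _ => norm_nonneg _) (Finset.prod_nonneg fun j _ => h0 j)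
    rw [← Equiv.prod_comp π (fun j => g (p.1 j))]
    exact Finset.prod_le_prod (fun _ _ => norm_nonneg _) fun j _ => hag _ _

theorem prod_integral_left {l : ℕ} (π : Equiv.Perm (Fin l)) (x : Fin l → X) :
    ∏ j, ∫ y, a (x (π j)) y * conj (a (x j) y) ∂ν =
      ∫ y : Fin l → Y, ∏ j, (a (x (π j)) (y j) * conj (a (x j) (y j))) ∂(Measure.pi fun _ => ν) :=
  (integral_fintype_prod_eq_prod (μ := fun _ : Fin l => ν)
    (fun j y => a (x (π j)) y * conj (a (x j) y))).symm

/-- Naming the integration variable of the j-th factor x (π j) produces the integrand of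
`prod_integral_left` with the same π, so the signs in the two determinants match. -/
theorem prod_integral_right {l : ℕ} (π : Equiv.Perm (Fin l)) (y : Fin l → Y) :
    ∏ j, ∫ x, conj (a x (y (π j))) * a x (y j) ∂μ =
      ∫ x : Fin l → X, ∏ j, (a (x (π j)) (y j) * conj (a (x j) (y j))) ∂(Measure.pi fun _ => μ) := by
  rw [← Equiv.prod_comp π.symm]
  simp only [Equiv.apply_symm_apply]
  rw [← integral_fintype_prod_eq_prod (μ := fun _ : Fin l => μ)
    (fun j x => conj (a x (y j)) * a x (y (π.symm j)))]
  refine integral_congr_ae (Eventually.of_forall fun x => ?_)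
  simp only [Finset.prod_mul_distrib]
  rw [mul_comm, ← Equiv.prod_comp π (fun j => a (x j) (y (π.symm j)))]
  simp only [Equiv.symm_apply_apply]

theorem integrable_prod_left (ha : Measurable (Function.uncurry a)) (hg : MemLp g 2 μ)
    (hag : ∀ x y, ‖a x y‖ ≤ g x) {l : ℕ} (π : Equiv.Perm (Fin l)) :
    Integrable (fun x : Fin l → X => ∏ j, ∫ y, a (x (π j)) y * conj (a (x j) y) ∂ν)
      (Measure.pi fun _ => μ) := by
  simp only [prod_integral_left]
  exact (integrable_andreief ha hg hag π).integral_prod_left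

theorem integrable_prod_right (ha : Measurable (Function.uncurry a)) (hg : MemLp g 2 μ)
    (hag : ∀ x y, ‖a x y‖ ≤ g x) {l : ℕ} (π : Equiv.Perm (Fin l)) :
    Integrable (fun y : Fin l → Y => ∏ j, ∫ x, conj (a x (y (π j))) * a x (y j) ∂μ)
      (Measure.pi fun _ => ν) := by
  simp only [prod_integral_right]
  exact (integrable_andreief ha hg hag π).integral_prod_right

theorem integrable_det_left (ha : Measurable (Function.uncurry a)) (hg : MemLp g 2 μ)
    (hag : ∀ x y, ‖a x y‖ ≤ g x) (l : ℕ) :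
    Integrable (fun x : Fin l → X =>
      Matrix.det (Matrix.of fun j k => ∫ y, a (x j) y * conj (a (x k) y) ∂ν))
      (Measure.pi fun _ => μ) := by
  simp only [Matrix.det_apply', Matrix.of_apply]
  exact integrable_finsetSum _ fun π _ => (integrable_prod_left ha hg hag π).const_mul _

/-- Andréief's identity: the Fredholm determinants of `A A*` and `A* A` agree term by term. -/
theorem integral_det_eq_integral_det (ha : Measurable (Function.uncurry a)) (hg : MemLp g 2 μ)
    (hag : ∀ x y, ‖a x y‖ ≤ g x) (l : ℕ) :
    ∫ x : Fin l → X, Matrix.det (Matrix.of fun j k => ∫ y, a (x j) y * conj (a (x k) y) ∂ν)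
        ∂(Measure.pi fun _ => μ) =
      ∫ y : Fin l → Y, Matrix.det (Matrix.of fun j k => ∫ x, conj (a x (y j)) * a x (y k) ∂μ)
        ∂(Measure.pi fun _ => ν) := by
  simp only [Matrix.det_apply', Matrix.of_apply]
  rw [integral_finsetSum _ fun π _ => (integrable_prod_left ha hg hag π).const_mul _,
    integral_finsetSum _ fun π _ => (integrable_prod_right ha hg hag π).const_mul _]
  refine Finset.sum_congr rfl fun π _ => ?_
  rw [integral_const_mul, integral_const_mul]
  simp only [prod_integral_left, prod_integral_right]
  rw [integral_integral_swap (integrable_andreief ha hg hag π)]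

/-- Andréief's identity for a finite sum of products. -/
theorem integral_det_sum_eq {ι : Type*} [Fintype ι] [DecidableEq ι] {f : Y → ι → ℂ}
    (hf : ∀ i, Measurable fun y => f y i) {C : ℝ} (hC : ∀ y i, ‖f y i‖ ≤ C) {c : ι → ℂ}
    (hc : ∀ m n, ∫ y, conj (f y m) * f y n ∂ν = if m = n then c n else 0) (l : ℕ) :
    ∫ y : Fin l → Y, Matrix.det (Matrix.of fun j k => ∑ i, f (y j) i * conj (f (y k) i))
        ∂(Measure.pi fun _ => ν) =
      l.factorial * ∑ s ∈ (Finset.univ : Finset ι).powersetCard l, ∏ i ∈ s, c i := by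
  let _ : MeasurableSpace ι := ⊤
  have hm : Measurable (Function.uncurry f) := measurable_from_prod_countable_left hf
  -- The sum over i is an integral against counting measure, so ι plays the role of the second
  -- space.
  have h := integral_det_eq_integral_det (μ := ν) (ν := Measure.count) hm (memLp_const C) hC l
  simp only [integral_count] at h
  rw [h]
  simp only [hc]
  rw [integral_fintype .of_finite, ← sum_det_of_ite_eq]
  refine Finset.sum_congr rfl fun n _ => ?_
  have : (Measure.pi fun _ : Fin l => (Measure.count : Measure ι)).real {n} = 1 := by
    simp [Measure.real, Measure.pi_singleton]
  rw [this, one_smul]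

end Andreief

/-! ### Eigenvalue products of compact symmetric operators as Fredholm series. -/

section Spectral

open scoped ComplexConjugate InnerProductSpace

variable {H : Type*} [NormedAddCommGroup H] [InnerProductSpace ℂ H]

/-- Orthonormal vectors are √2 apart, so balls of radius 1/2 around them are disjoint. Countability
makes `atTop` on `Finset ι` countably generated, as dominated convergence requires. -/
theorem countable_of_orthonormal [TopologicalSpace.SeparableSpace H] {ι : Type*} {v : ι → H}
    (hv : Orthonormal ℂ v) : Countable ι := by
  rw [← Set.countable_univ_iff]
  refine Set.PairwiseDisjoint.countable_of_isOpen (s := fun i => Metric.ball (v i) (1 / 2)) ?_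
    (fun _ _ => Metric.isOpen_ball) (fun i _ => ⟨v i, Metric.mem_ball_self (by norm_num)⟩)
  intro i _ j _ hij
  refine Metric.ball_disjoint_ball ?_
  have h : ‖v i - v j‖ ^ 2 = 2 := by
    rw [@norm_sub_sq ℂ, hv.1 i, hv.1 j, hv.2 hij]
    simp
    norm_num
  rw [dist_eq_norm]
  nlinarith [norm_nonneg (v i - v j)]

variable [CompleteSpace H] {T : H →L[ℂ] H}

/-- A Hilbert basis of eigenvectors of a compact symmetric operator. -/
theorem exists_hilbertBasis_eigenspace (hT : IsCompactOperator T) (hS : T.IsSymmetric) :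
    ∃ (w : ∀ ω : ℂ, Set (Module.End.eigenspace (T : H →ₗ[ℂ] H) ω))
      (b : HilbertBasis (Σ ω, w ω) ℂ H), (∀ i, T (b i) = i.1 • b i) ∧
      ∀ ω ≠ 0, Finite (w ω) ∧
        Nat.card (w ω) = Module.finrank ℂ (Module.End.eigenspace (T : H →ₗ[ℂ] H) ω) := by
  have hcl : ∀ ω, CompleteSpace (Module.End.eigenspace (T : H →ₗ[ℂ] H) ω) := fun ω => by
    have : IsClosed (Module.End.eigenspace (T : H →ₗ[ℂ] H) ω : Set H) := by
      have h : (Module.End.eigenspace (T : H →ₗ[ℂ] H) ω : Set H) = {x | T x = ω • x} := by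
        ext x
        simp
      rw [h]
      exact isClosed_eq T.continuous (continuous_const_smul ω)
    exact this.completeSpace_coe
  -- All ω are allowed: ω = 0 supplies a basis of the kernel, and the basis is empty when ω is not
  -- an eigenvalue.
  choose w b hb using fun ω => exists_hilbertBasis ℂ (Module.End.eigenspace (T : H →ₗ[ℂ] H) ω)
  have hon : Orthonormal ℂ fun i : Σ ω, w ω => (b i.1 i.2 : H) :=
    (LinearMap.IsSymmetric.orthogonalFamily_eigenspaces hS).orthonormal_sigma_orthonormal
      fun ω => (b ω).orthonormal
  have hspan : (Submodule.span ℂ (Set.range fun i : Σ ω, w ω => (b i.1 i.2 : H)))ᗮ = ⊥ := by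
    rw [← ContinuousLinearMap.orthogonalComplement_iSup_eigenspaces_eq_bot hT hS]
    refine le_antisymm ?_ (Submodule.orthogonal_le (Submodule.span_le.2 ?_))
    · rw [← Submodule.iInf_orthogonal]
      refine le_iInf fun ω => ?_
      intro x hx v hv
      have h1 := ((b ω).hasSum_repr ⟨v, hv⟩).mapL
        (Module.End.eigenspace (T : H →ₗ[ℂ] H) ω).subtypeL
      have h2 := h1.mapL ((innerSL ℂ) x)
      have h3 : ∀ i, ⟪x, (b ω i : H)⟫_ℂ = 0 := fun i => by
        rw [← inner_conj_symm, hx _ (Submodule.subset_span ⟨⟨ω, i⟩, rfl⟩), map_zero]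
      simp only [map_smul, Submodule.subtypeL_apply, innerSL_apply_apply, h3, smul_zero] at h2
      rw [← inner_conj_symm, ← hasSum_zero.unique h2, map_zero]
    · rintro _ ⟨i, rfl⟩
      exact (le_iSup (fun ω => Module.End.eigenspace (T : H →ₗ[ℂ] H) ω) i.1) (b i.1 i.2).2
  refine ⟨w, HilbertBasis.mkOfOrthogonalEqBot hon hspan, fun i => ?_, fun ω hω => ?_⟩
  · rw [HilbertBasis.coe_mkOfOrthogonalEqBot]
    exact Module.End.mem_eigenspace_iff.1 (b i.1 i.2).2
  · have := ContinuousLinearMap.finite_dimensional_eigenspace hT ω hω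
    have hfin : Finite (w ω) := (b ω).orthonormal.linearIndependent.finite
    refine ⟨hfin, ?_⟩
    have := Fintype.ofFinite (w ω)
    rw [Module.finrank_eq_card_basis (b ω).toOrthonormalBasis.toBasis, Nat.card_eq_fintype_card]

variable {Y : Type*} [MeasurableSpace Y] {ν : Measure Y} [IsFiniteMeasure ν] {A : Y → H} {C : ℝ}

/-- The hypothesis `hTA` is the weak form of T = ∫ ⟨A y, ·⟩ A y dν, a superposition of rank-one
symmetric operators. -/
theorem isSymmetric_of_inner_eq_integral
    (hTA : ∀ f g, ⟪f, T g⟫_ℂ = ∫ y, ⟪f, A y⟫_ℂ * ⟪A y, g⟫_ℂ ∂ν) : T.IsSymmetric := by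
  intro f g
  change ⟪T f, g⟫_ℂ = ⟪f, T g⟫_ℂ
  rw [← inner_conj_symm, hTA, hTA, ← integral_conj]
  refine integral_congr_ae (Eventually.of_forall fun y => ?_)
  simp only [map_mul, inner_conj_symm]
  rw [mul_comm]

/-- Bessel's inequality bounds the truncated Gram kernels independently of s, so one Hadamard
majorant serves all truncations. -/
theorem norm_sum_inner_mul_inner_le {ι : Type*} {b : ι → H} (hb : Orthonormal ℂ b)
    (s : Finset ι) (x y : H) {C : ℝ} (hx : ‖x‖ ≤ C) (hy : ‖y‖ ≤ C) :
    ‖∑ i ∈ s, ⟪x, b i⟫_ℂ * ⟪b i, y⟫_ℂ‖ ≤ C ^ 2 := by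
  have hx2 := (hb.sum_inner_products_le (s := s) x).trans (pow_le_pow_left₀ (norm_nonneg _) hx 2)
  have hy2 := (hb.sum_inner_products_le (s := s) y).trans (pow_le_pow_left₀ (norm_nonneg _) hy 2)
  calc ‖∑ i ∈ s, ⟪x, b i⟫_ℂ * ⟪b i, y⟫_ℂ‖
      ≤ ∑ i ∈ s, (‖⟪b i, x⟫_ℂ‖ ^ 2 + ‖⟪b i, y⟫_ℂ‖ ^ 2) / 2 := by
        refine norm_sum_le_of_le _ fun i _ => ?_
        rw [norm_mul, norm_inner_symm]
        nlinarith [sq_nonneg (‖⟪b i, x⟫_ℂ‖ - ‖⟪b i, y⟫_ℂ‖)]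
    _ ≤ C ^ 2 := by
        rw [← Finset.sum_div, Finset.sum_add_distrib]
        linarith

variable {ι : Type*} {b : HilbertBasis ι ℂ H} {c : ι → ℂ}

theorem integral_inner_eq_ite [DecidableEq ι] (hb : ∀ i, T (b i) = c i • b i)
    (hTA : ∀ f g, ⟪f, T g⟫_ℂ = ∫ y, ⟪f, A y⟫_ℂ * ⟪A y, g⟫_ℂ ∂ν) (m n : ι) :
    ∫ y, conj ⟪A y, b m⟫_ℂ * ⟪A y, b n⟫_ℂ ∂ν = if m = n then c n else 0 := by
  simp only [inner_conj_symm]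
  rw [← hTA, hb, inner_smul_right, orthonormal_iff_ite.1 b.orthonormal]
  simp

/-- Trace bound: c i = ∫ |⟨A y, b i⟩|² dν, and by Bessel these integrals sum to at most ∫ C² dν. -/
theorem summable_norm_of_eigenbasis (hA : ∀ h, Measurable fun y => ⟪A y, h⟫_ℂ)
    (hC : ∀ y, ‖A y‖ ≤ C) (hb : ∀ i, T (b i) = c i • b i)
    (hTA : ∀ f g, ⟪f, T g⟫_ℂ = ∫ y, ⟪f, A y⟫_ℂ * ⟪A y, g⟫_ℂ ∂ν) :
    Summable fun i => ‖c i‖ := by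
  classical
  have hint : ∀ i, Integrable (fun y => ‖⟪A y, b i⟫_ℂ‖ ^ 2) ν := fun i => by
    refine (integrable_const (C ^ 2)).mono' ((hA _).norm.pow_const 2).aestronglyMeasurable
      (Eventually.of_forall fun y => ?_)
    rw [Real.norm_of_nonneg (by positivity)]
    refine pow_le_pow_left₀ (norm_nonneg _) ((norm_inner_le_norm _ _).trans ?_) 2
    rw [b.orthonormal.1 i, mul_one]
    exact hC y
  refine summable_of_sum_le (c := ∫ _, C ^ 2 ∂ν) (fun i => norm_nonneg _) fun s => ?_
  calc ∑ i ∈ s, ‖c i‖ ≤ ∑ i ∈ s, ∫ y, ‖⟪A y, b i⟫_ℂ‖ ^ 2 ∂ν := by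
        refine Finset.sum_le_sum fun i _ => ?_
        have h := integral_inner_eq_ite hb hTA i i
        rw [if_pos rfl] at h
        rw [← h]
        refine (norm_integral_le_integral_norm _).trans (le_of_eq ?_)
        refine integral_congr_ae (Eventually.of_forall fun y => ?_)
        simp only [norm_mul, RCLike.norm_conj, sq]
    _ = ∫ y, ∑ i ∈ s, ‖⟪A y, b i⟫_ℂ‖ ^ 2 ∂ν := (integral_finsetSum _ fun i _ => hint i).symm
    _ ≤ ∫ _, C ^ 2 ∂ν := by
        refine integral_mono (integrable_finsetSum _ fun i _ => hint i) (integrable_const _)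
          fun y => ?_
        have h := b.orthonormal.sum_inner_products_le (s := s) (A y)
        simp only [norm_inner_symm (A y)]
        exact h.trans (pow_le_pow_left₀ (norm_nonneg _) (hC y) 2)

theorem norm_integral_det_le {l : ℕ} {M : (Fin l → Y) → Matrix (Fin l) (Fin l) ℂ} {C : ℝ}
    (hM : ∀ y j k, ‖M y j k‖ ≤ C) :
    ‖((-1 : ℂ) ^ l / (l.factorial : ℂ)) * ∫ y, (M y).det ∂(Measure.pi fun _ => ν)‖ ≤
      (Real.sqrt l * (C * ν.real univ)) ^ l / l.factorial := by
  have h : ‖∫ y, (M y).det ∂(Measure.pi fun _ => ν)‖ ≤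
      (Real.sqrt l * C) ^ l * (Measure.pi fun _ : Fin l => ν).real univ :=
    norm_integral_le_of_norm_le_const
      (Eventually.of_forall fun y => norm_det_le_of_norm_le _ (hM y))
  have h2 : (Measure.pi fun _ : Fin l => ν).real univ = ν.real univ ^ l := by
    simp [Measure.real, Measure.pi_univ]
  rw [h2] at h
  rw [norm_mul, norm_div, norm_pow, norm_neg, norm_one, one_pow, RCLike.norm_natCast, one_div,
    inv_mul_eq_div]
  gcongr
  refine h.trans_eq ?_
  rw [← mul_pow, mul_assoc]

/-- The Fredholm series of a Gram kernel is the product over an eigenbasis. -/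
theorem hasProd_one_sub_eigenbasis [TopologicalSpace.SeparableSpace H]
    (hA : ∀ h, Measurable fun y => ⟪A y, h⟫_ℂ)
    (hC : ∀ y, ‖A y‖ ≤ C) (hb : ∀ i, T (b i) = c i • b i)
    (hTA : ∀ f g, ⟪f, T g⟫_ℂ = ∫ y, ⟪f, A y⟫_ℂ * ⟪A y, g⟫_ℂ ∂ν) :
    HasProd (fun i => 1 - c i) (∑' l : ℕ, ((-1 : ℂ) ^ l / (l.factorial : ℂ)) *
      ∫ y : Fin l → Y, Matrix.det (Matrix.of fun j k => ⟪A (y j), A (y k)⟫_ℂ)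
        ∂(Measure.pi fun _ => ν)) := by
  classical
  have : Countable ι := countable_of_orthonormal b.orthonormal
  -- The functions y ↦ ⟨A y, b i⟩ are orthogonal in L²(ν) with squared norms c i, so a finite
  -- product is the Fredholm series of the Gram kernel truncated to s.
  have hfin : ∀ s : Finset ι, ∏ i ∈ s, (1 - c i) =
      ∑' l : ℕ, ((-1 : ℂ) ^ l / (l.factorial : ℂ)) * ∫ y : Fin l → Y,
        Matrix.det (Matrix.of fun j k => ∑ i ∈ s, ⟪A (y j), b i⟫_ℂ * ⟪b i, A (y k)⟫_ℂ)
          ∂(Measure.pi fun _ => ν) := fun s => by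
    rw [← Finset.prod_coe_sort, ← (hasSum_prod_one_sub fun i : s => c i).tsum_eq]
    refine tsum_congr fun l => ?_
    have h := integral_det_sum_eq (ν := ν) (f := fun y (i : s) => ⟪A y, b i⟫_ℂ) (C := C)
      (c := fun i : s => c i) (fun i => hA _) (fun y i => ?_) (fun m n => ?_) l
    · simp only [inner_conj_symm] at h
      simp only [← Finset.sum_coe_sort s]
      have hf : (l.factorial : ℂ) ≠ 0 := by exact_mod_cast l.factorial_ne_zero
      rw [h]
      field_simp
    · refine (norm_inner_le_norm _ _).trans ?_
      rw [b.orthonormal.1 i, mul_one]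
      exact hC y
    · rw [integral_inner_eq_ite hb hTA]
      simp only [Subtype.coe_inj]
  unfold HasProd
  simp only [hfin]
  have hbd : ∀ (s : Finset ι) (l : ℕ) (y : Fin l → Y) (j k : Fin l),
      ‖(Matrix.of fun j k => ∑ i ∈ s, ⟪A (y j), b i⟫_ℂ * ⟪b i, A (y k)⟫_ℂ :
        Matrix (Fin l) (Fin l) ℂ) j k‖ ≤ C ^ 2 := fun s l y j k => by
    rw [Matrix.of_apply]
    exact norm_sum_inner_mul_inner_le b.orthonormal s _ _ (hC _) (hC _)
  -- Dominated convergence is used for the series and then for each integral, with majorants from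
  -- Hadamard's bound. Pointwise convergence of the entries is Parseval's identity.
  refine tendsto_tsum_of_dominated_convergence
    (summable_sqrt_mul_pow_div_factorial (C ^ 2 * ν.real univ)) (fun l => ?_)
    (Eventually.of_forall fun s l => norm_integral_det_le (hbd s l))
  refine Tendsto.const_mul _ ?_
  refine tendsto_integral_filter_of_dominated_convergence (fun _ => (Real.sqrt l * C ^ 2) ^ l)
    (Eventually.of_forall fun s => ?_)
    (Eventually.of_forall fun s => Eventually.of_forall fun y =>
      norm_det_le_of_norm_le _ (hbd s l y))
    (integrable_const _) (Eventually.of_forall fun y => ?_)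
  · refine Measurable.aestronglyMeasurable ?_
    simp only [Matrix.det_apply', Matrix.of_apply]
    have h1 : ∀ (i : ι) (j : Fin l), Measurable fun y : Fin l → Y => ⟪A (y j), b i⟫_ℂ :=
      fun i j => (hA (b i)).comp (measurable_pi_apply j)
    have h2 : ∀ (i : ι) (j : Fin l), Measurable fun y : Fin l → Y => ⟪b i, A (y j)⟫_ℂ :=
      fun i j => by
        have := Complex.continuous_conj.measurable.comp (h1 i j)
        simpa only [Function.comp_def, inner_conj_symm] using this
    exact Finset.measurable_sum _ fun π _ => (Finset.measurable_prod _ fun j _ =>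
      Finset.measurable_sum _ fun i _ => (h1 _ _).mul (h2 _ _)).const_mul _
  · have hdet : Continuous fun M : Matrix (Fin l) (Fin l) ℂ => M.det :=
      continuous_id.matrix_det
    refine (hdet.tendsto _).comp ?_
    refine tendsto_pi_nhds.2 fun j => tendsto_pi_nhds.2 fun k => ?_
    exact b.hasSum_inner_mul_inner (A (y j)) (A (y k))

/-- Symmetry makes generalized eigenspaces equal to eigenspaces, so the algebraic multiplicity of ω
≠ 0 counts the basis vectors with eigenvalue ω. Grouping the basis by eigenvalue gives the claim. -/
theorem eigenSummable_and_eigenProd_eq [TopologicalSpace.SeparableSpace H]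
    (hT : IsCompactOperator T) (hA : ∀ h, Measurable fun y => ⟪A y, h⟫_ℂ)
    (hC : ∀ y, ‖A y‖ ≤ C)
    (hTA : ∀ f g, ⟪f, T g⟫_ℂ = ∫ y, ⟪f, A y⟫_ℂ * ⟪A y, g⟫_ℂ ∂ν) :
    EigenSummable (T : H →ₗ[ℂ] H) ∧ eigenProd (T : H →ₗ[ℂ] H) =
      ∑' l : ℕ, ((-1 : ℂ) ^ l / (l.factorial : ℂ)) *
        ∫ y : Fin l → Y, Matrix.det (Matrix.of fun j k => ⟪A (y j), A (y k)⟫_ℂ)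
          ∂(Measure.pi fun _ => ν) := by
  have hS := isSymmetric_of_inner_eq_integral hTA
  have hgen : ∀ ω, Module.End.maxGenEigenspace (T : H →ₗ[ℂ] H) ω =
      Module.End.eigenspace (T : H →ₗ[ℂ] H) ω := fun ω =>
    (LinearMap.IsSymmetric.isFinitelySemisimple hS).maxGenEigenspace_eq_eigenspace ω
  obtain ⟨w, b, hb, hw⟩ := exists_hilbertBasis_eigenspace hT hS
  have hmult : ∀ ω ≠ 0, algMult (T : H →ₗ[ℂ] H) ω = Nat.card (w ω) := fun ω hω => by
    rw [algMult, hgen, (hw ω hω).2]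
  have hsum := summable_norm_of_eigenbasis hA hC hb hTA
  have hprod := hasProd_one_sub_eigenbasis hA hC hb hTA
  refine ⟨⟨fun ω => ?_, ?_⟩, ?_⟩
  · rw [hgen]
    exact ContinuousLinearMap.finite_dimensional_eigenspace hT _ ω.2.1
  · have h := hsum.sigma.comp_injective
      (Subtype.val_injective : Function.Injective
        (Subtype.val : NonzeroEigenvalue (T : H →ₗ[ℂ] H) → ℂ))
    refine h.congr fun ω => ?_
    rw [hmult _ ω.2.1]
    simp [tsum_const]
  -- The possibly infinite basis of the kernel contributes only factors 1; an ω that is not an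
  -- eigenvalue has multiplicity 0.
  · have hsig : HasProd (fun ω : ℂ => if ω = 0 then 1 else (1 - ω) ^ algMult (T : H →ₗ[ℂ] H) ω)
        _ := hprod.sigma fun ω => by
      split_ifs with hω
      · subst hω
        simp
      · have := (hw ω hω).1
        have := Fintype.ofFinite (w ω)
        have := hasProd_fintype fun _ : w ω => 1 - ω
        simpa [hmult ω hω] using this
    have hsub := (hasProd_subtype_iff_of_mulSupport_subset
      (s := {ω : ℂ | ω ≠ 0 ∧ Module.End.HasEigenvalue (T : H →ₗ[ℂ] H) ω}) (fun ω hω => ?_)).2 hsig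
    · rw [← hsub.tprod_eq]
      refine tprod_congr fun ω => ?_
      simp [ω.2.1]
    · by_contra hn
      apply hω
      by_cases h0 : ω = 0
      · simp [h0]
      · have : ¬ Module.End.HasEigenvalue (T : H →ₗ[ℂ] H) ω := fun h => hn ⟨h0, h⟩
        rw [Module.End.hasEigenvalue_iff, not_not] at this
        simp only [h0, if_false]
        rw [algMult, hgen, this, finrank_bot, pow_zero]

end Spectral

/-! ### Compactness of Hilbert–Schmidt operators. -/

section HilbertSchmidt

open scoped ComplexConjugate InnerProductSpace

variable {H : Type*} [NormedAddCommGroup H] [InnerProductSpace ℂ H] {ι : Type*}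
  {F : Type*} [NormedAddCommGroup F] [NormedSpace ℂ F]

theorem norm_sum_smul_le_of_orthonormal {b : ι → H} (hb : Orthonormal ℂ b) (v : ι → F)
    (s : Finset ι) (f : H) {ε : ℝ} (hε : 0 ≤ ε) (hs : ∑ i ∈ s, ‖v i‖ ^ 2 ≤ ε ^ 2) :
    ‖∑ i ∈ s, ⟪b i, f⟫_ℂ • v i‖ ≤ ε * ‖f‖ := by
  refine (norm_sum_le _ _).trans ?_
  simp only [norm_smul]
  refine abs_le_of_sq_le_sq' ?_ (by positivity) |>.2
  refine (Finset.sum_mul_sq_le_sq_mul_sq _ _ _).trans ?_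
  rw [mul_pow, mul_comm]
  exact mul_le_mul hs (hb.sum_inner_products_le f) (Finset.sum_nonneg fun _ _ => by positivity)
    (by positivity)

/-- Hilbert–Schmidt operators are compact. -/
theorem isCompactOperator_of_summable_sq [CompleteSpace F] (b : HilbertBasis ι ℂ H) (T : H →L[ℂ] F)
    (hT : Summable fun i => ‖T (b i)‖ ^ 2) : IsCompactOperator T := by
  classical
  have hid : IsCompactOperator (id : ℂ → ℂ) :=
    (isCompactOperator_id_iff_finiteDimensional (𝕜 := ℂ)).2 inferInstance
  have hfin : ∀ s : Finset ι, IsCompactOperator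
      (∑ i ∈ s, (innerSL ℂ (b i)).smulRight (T (b i)) : H →L[ℂ] F) := fun s => by
    refine Submodule.sum_mem (compactOperator (RingHom.id ℂ) H F) fun i _ => ?_
    exact (hid.comp_clm (innerSL ℂ (b i))).clm_comp
      ((ContinuousLinearMap.id ℂ ℂ).smulRight (T (b i)))
  -- The finite-rank truncations converge in operator norm: Cauchy–Schwarz and Bessel bound the tail
  -- by the square root of the tail of ∑ ‖T (b i)‖².
  refine isCompactOperator_of_tendsto (l := atTop)
    (F := fun s : Finset ι => ∑ i ∈ s, (innerSL ℂ (b i)).smulRight (T (b i))) ?_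
    (Eventually.of_forall hfin)
  rw [Metric.tendsto_atTop]
  intro ε hε
  obtain ⟨s, hs⟩ := summable_iff_vanishing.1 hT (Metric.ball 0 ((ε / 2) ^ 2))
    (Metric.ball_mem_nhds _ (by positivity))
  refine ⟨s, fun t ht => ?_⟩
  rw [dist_comm, dist_eq_norm]
  refine lt_of_le_of_lt (ContinuousLinearMap.opNorm_le_bound _ (by positivity) fun f => ?_)
    (half_lt_self hε)
  have h1 : HasSum (fun i => ⟪b i, f⟫_ℂ • T (b i)) (T f) := by
    have := (b.hasSum_repr f).mapL T
    simpa only [map_smul, HilbertBasis.repr_apply_apply] using this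
  have h2 : Tendsto (fun u : Finset ι => ∑ i ∈ u, ⟪b i, f⟫_ℂ • T (b i) -
      ∑ i ∈ t, ⟪b i, f⟫_ℂ • T (b i)) atTop
      (𝓝 ((T - ∑ i ∈ t, (innerSL ℂ (b i)).smulRight (T (b i))) f)) := by
    simpa [sum_apply] using Tendsto.sub_const h1 _
  refine le_of_tendsto h2.norm (eventually_atTop.2 ⟨t, fun u hu => ?_⟩)
  rw [← Finset.sum_sdiff hu, add_sub_cancel_right]
  refine norm_sum_smul_le_of_orthonormal b.orthonormal _ _ _ (by positivity) ?_
  have h3 := hs (u \ t) (Finset.sdiff_disjoint.mono_right ht)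
  rw [mem_ball_zero_iff] at h3
  exact (le_abs_self _).trans h3.le

variable {X : Type*} [MeasurableSpace X] {μ : Measure X}

theorem norm_sq_eq_integral (f : Lp ℂ 2 μ) : ‖f‖ ^ 2 = ∫ x, ‖f x‖ ^ 2 ∂μ := by
  have h := L2.inner_def (𝕜 := ℂ) f f
  rw [inner_self_eq_norm_sq_to_K] at h
  have h2 : ∫ x, ⟪f x, f x⟫_ℂ ∂μ = ((∫ x, ‖f x‖ ^ 2 ∂μ : ℝ) : ℂ) := by
    rw [← integral_complex_ofReal]
    refine integral_congr_ae (Eventually.of_forall fun x => ?_)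
    simp only [inner_self_eq_norm_sq_to_K]
    push_cast
    rfl
  rw [h2] at h
  refine Complex.ofReal_injective (Eq.trans ?_ h)
  push_cast
  rfl

variable {T : H →ₗ[ℂ] Lp ℂ 2 μ} {k : X → H} {G : X → ℝ}

/-- Bessel's inequality for the row k x at almost every x, integrated over x, bounds the
Hilbert–Schmidt norm. -/
theorem sum_norm_sq_le_of_kernel {b : ι → H} (hb : Orthonormal ℂ b)
    (hT : ∀ f, T f =ᵐ[μ] fun x => ⟪k x, f⟫_ℂ) (hG : MemLp G 2 μ) (hk : ∀ x, ‖k x‖ ≤ G x)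
    (s : Finset ι) : ∑ i ∈ s, ‖T (b i)‖ ^ 2 ≤ ∫ x, G x ^ 2 ∂μ := by
  have hint : ∀ i, Integrable (fun x => ‖T (b i) x‖ ^ 2) μ := fun i => by
    simpa using (Lp.memLp (T (b i))).integrable_norm_pow (by norm_num)
  simp only [norm_sq_eq_integral]
  rw [← integral_finsetSum _ fun i _ => hint i]
  refine integral_mono_ae (integrable_finsetSum _ fun i _ => hint i) hG.integrable_sq ?_
  have hall : ∀ᵐ x ∂μ, ∀ i ∈ s, T (b i) x = ⟪k x, b i⟫_ℂ :=
    (Finset.eventually_all s).2 fun i _ => hT (b i)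
  filter_upwards [hall] with x hx
  calc ∑ i ∈ s, ‖T (b i) x‖ ^ 2 = ∑ i ∈ s, ‖⟪b i, k x⟫_ℂ‖ ^ 2 :=
        Finset.sum_congr rfl fun i hi => by rw [hx i hi, norm_inner_symm]
    _ ≤ ‖k x‖ ^ 2 := hb.sum_inner_products_le _
    _ ≤ G x ^ 2 := pow_le_pow_left₀ (norm_nonneg _) (hk x) 2

theorem norm_sq_le_of_kernel (hT : ∀ f, T f =ᵐ[μ] fun x => ⟪k x, f⟫_ℂ) (hG : MemLp G 2 μ)
    (hk : ∀ x, ‖k x‖ ≤ G x) (f : H) : ‖T f‖ ^ 2 ≤ (∫ x, G x ^ 2 ∂μ) * ‖f‖ ^ 2 := by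
  rw [norm_sq_eq_integral, ← integral_mul_const]
  refine integral_mono_ae (by simpa using (Lp.memLp (T f)).integrable_norm_pow (by norm_num))
    (hG.integrable_sq.mul_const _) ?_
  filter_upwards [hT f] with x hx
  rw [hx, ← mul_pow]
  exact pow_le_pow_left₀ (norm_nonneg _)
    ((norm_inner_le_norm _ _).trans (mul_le_mul_of_nonneg_right (hk x) (norm_nonneg _))) 2

/-- An integral operator with square-integrable kernel is bounded and compact. -/
theorem exists_compact_of_kernel [CompleteSpace H] (hT : ∀ f, T f =ᵐ[μ] fun x => ⟪k x, f⟫_ℂ)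
    (hG : MemLp G 2 μ) (hk : ∀ x, ‖k x‖ ≤ G x) :
    ∃ S : H →L[ℂ] Lp ℂ 2 μ, (S : H →ₗ[ℂ] Lp ℂ 2 μ) = T ∧ IsCompactOperator S := by
  have hG0 : 0 ≤ ∫ x, G x ^ 2 ∂μ := integral_nonneg fun _ => by positivity
  let S : H →L[ℂ] Lp ℂ 2 μ := T.mkContinuous (Real.sqrt (∫ x, G x ^ 2 ∂μ)) fun f => by
    refine (abs_le_of_sq_le_sq' ?_ (by positivity)).2
    rw [mul_pow, Real.sq_sqrt hG0]
    exact norm_sq_le_of_kernel hT hG hk f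
  refine ⟨S, rfl, ?_⟩
  obtain ⟨w, b, -⟩ := exists_hilbertBasis ℂ H
  exact isCompactOperator_of_summable_sq b S (summable_of_sum_le (fun _ => by positivity)
    fun s => sum_norm_sq_le_of_kernel b.orthonormal hT hG hk s)

end HilbertSchmidt

/-! ### Integral operators of the form A A*. -/

section Factor

open scoped ComplexConjugate InnerProductSpace

variable {X Y : Type*} [MeasurableSpace X] {μ : Measure X} [SigmaFinite μ]
  [MeasurableSpace Y] {ν : Measure Y} [IsFiniteMeasure ν] {a : X → Y → ℂ} {g : X → ℝ}
  {K : X → X → ℂ}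

theorem norm_factor_kernel_le (hag : ∀ x y, ‖a x y‖ ≤ g x)
    (hK : ∀ x x', K x x' = ∫ y, a x y * conj (a x' y) ∂ν) (x x' : X) :
    ‖K x x'‖ ≤ g x * g x' * ν.real univ := by
  rw [hK]
  refine norm_integral_le_of_norm_le_const (Eventually.of_forall fun y => ?_)
  rw [norm_mul, RCLike.norm_conj]
  exact mul_le_mul (hag _ _) (hag _ _) (norm_nonneg _) ((norm_nonneg _).trans (hag x y))

theorem measurable_factor_kernel (ha : Measurable (Function.uncurry a))
    (hK : ∀ x x', K x x' = ∫ y, a x y * conj (a x' y) ∂ν) :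
    Measurable fun p : X × X => K p.1 p.2 := by
  simp only [hK]
  have h1 : Measurable fun q : (X × X) × Y => a q.1.1 q.2 := by
    have h : Measurable fun q : (X × X) × Y => (q.1.1, q.2) := by fun_prop
    exact ha.comp h
  have h2 : Measurable fun q : (X × X) × Y => a q.1.2 q.2 := by
    have h : Measurable fun q : (X × X) × Y => (q.1.2, q.2) := by fun_prop
    exact ha.comp h
  have h3 := (h1.mul (Complex.continuous_conj.measurable.comp h2)).stronglyMeasurable
  exact (h3.integral_prod_right' (ν := ν)).measurable

/-- Fubini turns K = A A* into the weak identity that serves as the hypothesis `hTA` of the spectral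
results. -/
theorem inner_eq_integral_factor (ha : Measurable (Function.uncurry a))
    (hg : MemLp g 2 μ)
    (hag : ∀ x y, ‖a x y‖ ≤ g x) (hK : ∀ x x', K x x' = ∫ y, a x y * conj (a x' y) ∂ν)
    (f h : Lp ℂ 2 μ) :
    ∫ x, conj (f x) * ∫ x', K x x' * h x' ∂μ ∂μ =
      ∫ y, (∫ x, conj (f x) * a x y ∂μ) * (∫ x', conj (a x' y) * h x' ∂μ) ∂ν := by
  have hint : Integrable (fun q : (X × X) × Y =>
      (conj (f q.1.1) * a q.1.1 q.2) * (conj (a q.1.2 q.2) * h q.1.2)) ((μ.prod μ).prod ν) := by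
    have hf : Integrable (fun x => ‖f x‖ * g x) μ := (Lp.memLp f).norm.integrable_mul hg
    have hh : Integrable (fun x => g x * ‖h x‖) μ := hg.integrable_mul (Lp.memLp h).norm
    refine ((hf.mul_prod hh).comp_fst ν).mono' ?_ (Eventually.of_forall fun q => ?_)
    · refine Measurable.aestronglyMeasurable ?_
      have h1 : Measurable fun q : (X × X) × Y => a q.1.1 q.2 := by
        have h : Measurable fun q : (X × X) × Y => (q.1.1, q.2) := by fun_prop
        exact ha.comp h
      have h2 : Measurable fun q : (X × X) × Y => a q.1.2 q.2 := by
        have h : Measurable fun q : (X × X) × Y => (q.1.2, q.2) := by fun_prop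
        exact ha.comp h
      have h3 : Measurable fun q : (X × X) × Y => f q.1.1 :=
        (Lp.stronglyMeasurable f).measurable.comp (by fun_prop)
      have h4 : Measurable fun q : (X × X) × Y => h q.1.2 :=
        (Lp.stronglyMeasurable h).measurable.comp (by fun_prop)
      exact ((Complex.continuous_conj.measurable.comp h3).mul h1).mul
        ((Complex.continuous_conj.measurable.comp h2).mul h4)
    · simp only [norm_mul, RCLike.norm_conj]
      have := hag q.1.1 q.2
      have := hag q.1.2 q.2
      have : 0 ≤ g q.1.1 := (norm_nonneg _).trans (hag q.1.1 q.2)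
      gcongr
  have hKi : ∀ x x', conj (f x) * (K x x' * h x') =
      ∫ y, (conj (f x) * a x y) * (conj (a x' y) * h x') ∂ν := fun x x' => by
    rw [hK, ← integral_mul_const, ← integral_const_mul]
    refine integral_congr_ae (Eventually.of_forall fun y => ?_)
    simp only
    ring
  have h1 : Integrable (fun p : X × X => conj (f p.1) * (K p.1 p.2 * h p.2)) (μ.prod μ) := by
    simp only [hKi]
    exact hint.integral_prod_left
  calc ∫ x, conj (f x) * ∫ x', K x x' * h x' ∂μ ∂μ
      = ∫ x, ∫ x', conj (f x) * (K x x' * h x') ∂μ ∂μ := by simp only [integral_const_mul]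
    _ = ∫ p : X × X, conj (f p.1) * (K p.1 p.2 * h p.2) ∂(μ.prod μ) := (integral_prod _ h1).symm
    _ = ∫ p : X × X, ∫ y, (conj (f p.1) * a p.1 y) * (conj (a p.2 y) * h p.2) ∂ν ∂(μ.prod μ) := by
        simp only [hKi]
    _ = ∫ y, ∫ p : X × X, (conj (f p.1) * a p.1 y) * (conj (a p.2 y) * h p.2) ∂(μ.prod μ) ∂ν :=
        integral_integral_swap hint
    _ = _ := by
        refine integral_congr_ae (Eventually.of_forall fun y => ?_)
        exact integral_prod_mul (fun x => conj (f x) * a x y) (fun x' => conj (a x' y) * h x')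

/-- The eigenvalue product of `A A*` is the Fredholm series of `A* A`. -/
theorem integralOp_eigenSummable_and_eigenProd_eq {X : Type*} [MeasureSpace X]
    [SigmaFinite (volume : Measure X)] [MeasurableSpace.CountablyGenerated X] {Ω : Set X}
    {a : X → Y → ℂ} {g : X → ℝ} {K : X → X → ℂ}
    (ha : Measurable (Function.uncurry a)) (hg : MemLp g 2 (volume.restrict Ω))
    (hag : ∀ x y, ‖a x y‖ ≤ g x) (hK : ∀ x x', K x x' = ∫ y, a x y * conj (a x' y) ∂ν)
    (hsq : SqIntegrableKernel K Ω) :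
    EigenSummable (integralOp K Ω hsq) ∧ eigenProd (integralOp K Ω hsq) =
      ∑' l : ℕ, ((-1 : ℂ) ^ l / (l.factorial : ℂ)) *
        ∫ y : Fin l → Y, Matrix.det (Matrix.of fun j k => ∫ x in Ω, conj (a x (y j)) * a x (y k))
          ∂(Measure.pi fun _ => ν) := by
  set μ := (volume : Measure X).restrict Ω with hμ
  have ham : ∀ y, Measurable fun x => a x y := fun y =>
    ha.comp (measurable_id.prodMk measurable_const)
  have hmem : ∀ y, MemLp (fun x => a x y) 2 μ := fun y =>
    hg.of_le (ham y).aestronglyMeasurable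
      (Eventually.of_forall fun x => (hag x y).trans (le_abs_self _))
  -- The columns of the kernel a, as vectors of L²(Ω); their Gram kernel is the kernel of A* A.
  let A : Y → Lp ℂ 2 μ := fun y => (hmem y).toLp
  have hAL : ∀ y (f : Lp ℂ 2 μ), ⟪A y, f⟫_ℂ = ∫ x in Ω, conj (a x y) * f x := fun y f => by
    rw [L2.inner_def]
    refine integral_congr_ae ?_
    filter_upwards [(hmem y).coeFn_toLp] with x hx
    rw [hx, RCLike.inner_apply, mul_comm]
  have hAR : ∀ y (f : Lp ℂ 2 μ), ⟪f, A y⟫_ℂ = ∫ x in Ω, conj (f x) * a x y := fun y f => by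
    rw [L2.inner_def]
    refine integral_congr_ae ?_
    filter_upwards [(hmem y).coeFn_toLp] with x hx
    rw [hx, RCLike.inner_apply, mul_comm]
  have hAA : ∀ y y', ⟪A y, A y'⟫_ℂ = ∫ x in Ω, conj (a x y) * a x y' := fun y y' => by
    rw [hAL]
    refine integral_congr_ae ?_
    filter_upwards [(hmem y').coeFn_toLp] with x hx
    rw [hx]
  have hAm : ∀ f : Lp ℂ 2 μ, Measurable fun y => ⟪A y, f⟫_ℂ := fun f => by
    simp only [hAL]
    have h1 : Measurable fun p : X × Y => conj (a p.1 p.2) * f p.1 :=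
      (Complex.continuous_conj.measurable.comp ha).mul
        ((Lp.stronglyMeasurable f).measurable.comp measurable_fst)
    exact (h1.stronglyMeasurable.integral_prod_left' (μ := μ)).measurable
  have hAn : ∀ y, ‖A y‖ ≤ (eLpNorm g 2 μ).toReal := fun y => by
    rw [Lp.norm_toLp]
    refine ENNReal.toReal_mono hg.eLpNorm_ne_top (eLpNorm_mono fun x => ?_)
    exact (hag x y).trans (le_abs_self _)
  have hKm : ∀ x, Measurable fun x' => conj (K x x') := fun x =>
    Complex.continuous_conj.measurable.comp
      ((measurable_factor_kernel ha hK).comp (measurable_const.prodMk measurable_id))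
  have hKle : ∀ x x', ‖conj (K x x')‖ ≤ ‖(g x * ν.real univ) * g x'‖ := fun x x' => by
    rw [RCLike.norm_conj]
    refine (norm_factor_kernel_le hag hK x x').trans (le_of_eq_of_le ?_ (le_abs_self _))
    ring
  have hKmem : ∀ x, MemLp (fun x' => conj (K x x')) 2 μ := fun x =>
    (hg.const_mul (g x * ν.real univ)).of_le (hKm x).aestronglyMeasurable
      (Eventually.of_forall fun x' => hKle x x')
  -- Rows are conjugated because the inner product is conjugate-linear in its first slot.
  let k : X → Lp ℂ 2 μ := fun x => (hKmem x).toLp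
  have hkn : ∀ x, ‖k x‖ ≤ ‖g x * (ν.real univ * (eLpNorm g 2 μ).toReal)‖ := fun x => by
    rw [Lp.norm_toLp]
    have h1 : eLpNorm (fun x' => conj (K x x')) 2 μ ≤ ENNReal.ofReal |g x * ν.real univ| *
        eLpNorm g 2 μ := by
      refine (eLpNorm_mono (hKle x)).trans (le_of_eq ?_)
      have := eLpNorm_const_smul (g x * ν.real univ) g 2 μ
      rw [← Real.norm_eq_abs, ofReal_norm]
      exact this
    refine (ENNReal.toReal_mono
      (ENNReal.mul_ne_top ENNReal.ofReal_ne_top hg.eLpNorm_ne_top) h1).trans (le_of_eq ?_)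
    rw [ENNReal.toReal_mul, ENNReal.toReal_ofReal (abs_nonneg _), Real.norm_eq_abs, ← mul_assoc,
      abs_mul (g x * ν.real univ), abs_of_nonneg (ENNReal.toReal_nonneg (a := eLpNorm g 2 μ))]
  have hT : ∀ f, integralOp K Ω hsq f =ᵐ[μ] fun x => ⟪k x, f⟫_ℂ := fun f => by
    refine (hsq.memLp_integral f).coeFn_toLp.trans (Eventually.of_forall fun x => ?_)
    simp only
    rw [L2.inner_def]
    refine integral_congr_ae ?_
    filter_upwards [(hKmem x).coeFn_toLp] with x' hx'
    rw [hx', RCLike.inner_apply, Complex.conj_conj, mul_comm]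
  obtain ⟨S, hS, hcomp⟩ := exists_compact_of_kernel (T := integralOp K Ω hsq) hT
    (hg.mul_const (ν.real univ * (eLpNorm g 2 μ).toReal)).norm hkn
  have hweak : ∀ f h, ⟪f, S h⟫_ℂ = ∫ y, ⟪f, A y⟫_ℂ * ⟪A y, h⟫_ℂ ∂ν := fun f h => by
    simp only [hAL, hAR]
    rw [← inner_eq_integral_factor ha hg hag hK, L2.inner_def]
    have hSh : S h = integralOp K Ω hsq h := by rw [← hS]; rfl
    rw [hSh]
    refine integral_congr_ae ?_
    filter_upwards [(hsq.memLp_integral h).coeFn_toLp] with x hx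
    rw [RCLike.inner_apply, mul_comm]
    congr 1
  have : Fact ((2 : ENNReal) ≠ ⊤) := ⟨by norm_num⟩
  have : SecondCountableTopology (Lp ℂ 2 μ) := Lp.SecondCountableTopology
  have := eigenSummable_and_eigenProd_eq hcomp hAm hAn hweak
  rw [hS] at this
  simpa only [hAA] using this

end Factor

/-! ### Transfer of the Fredholm data from A A* to A* A. -/

section Series

open scoped ComplexConjugate

theorem fredholmTerm_eq {X : Type*} [MeasureSpace X] [SigmaFinite (volume : Measure X)]
    (K : X → X → ℂ) (Ω : Set X) (l : ℕ) :
    fredholmTerm K Ω l = ((-1 : ℂ) ^ l / (l.factorial : ℂ)) *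
      ∫ x : Fin l → X, Matrix.det (Matrix.of fun j k => K (x j) (x k))
        ∂(Measure.pi fun _ => volume.restrict Ω) := by
  rw [fredholmTerm, volume_pi, Measure.restrict_pi_pi]
  rfl

theorem fredholmTerm_zero {X : Type*} [MeasureSpace X] [SigmaFinite (volume : Measure X)]
    (K : X → X → ℂ) (Ω : Set X) : fredholmTerm K Ω 0 = 1 := by
  rw [fredholmTerm_eq]
  simp [Measure.real]

theorem fredholmSeries_eq_tsum {X : Type*} [MeasureSpace X] [SigmaFinite (volume : Measure X)]
    {K : X → X → ℂ} {Ω : Set X} (h : Summable (fredholmTerm K Ω)) :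
    fredholmSeries K Ω = ∑' l, fredholmTerm K Ω l := by
  rw [h.tsum_eq_zero_add, fredholmTerm_zero, fredholmSeries]

theorem fredholmTerm_congr {X : Type*} [MeasureSpace X] [SigmaFinite (volume : Measure X)]
    {K K' : X → X → ℂ} {Ω : Set X} (hΩ : MeasurableSet Ω)
    (h : ∀ x ∈ Ω, ∀ y ∈ Ω, K x y = K' x y) (l : ℕ) : fredholmTerm K Ω l = fredholmTerm K' Ω l := by
  unfold fredholmTerm
  congr 1
  refine setIntegral_congr_fun (MeasurableSet.univ_pi fun _ => hΩ) fun x hx => ?_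
  unfold corrDet
  congr 1
  ext j k
  exact h _ (hx j (mem_univ j)) _ (hx k (mem_univ k))

theorem norm_fredholmTerm_le {X : Type*} [MeasureSpace X] [SigmaFinite (volume : Measure X)]
    {K : X → X → ℂ} {Ω : Set X} (hΩ : volume Ω ≠ ⊤) {C : ℝ} (h : ∀ x y, ‖K x y‖ ≤ C)
    (l : ℕ) :
    ‖fredholmTerm K Ω l‖ ≤ (Real.sqrt l * (C * volume.real Ω)) ^ l / l.factorial := by
  have : IsFiniteMeasure (volume.restrict Ω) := ⟨by simpa using hΩ.lt_top⟩
  rw [fredholmTerm_eq]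
  have h2 := norm_integral_det_le (ν := volume.restrict Ω) (l := l)
    (M := fun x => Matrix.of fun j k => K (x j) (x k)) (C := C) fun x j k => h _ _
  simpa [measureReal_restrict_apply_univ] using h2

/-- If `K = A A*` on `Ω` and `κ = A* A` on `I`, where `A` has the bounded-by-`g` kernel `a`, then
all the Fredholm data of `K` are given by the Fredholm series of `κ`. -/
theorem fredholm_factor {X Y : Type*} [MeasureSpace X] [SigmaFinite (volume : Measure X)]
    [MeasurableSpace.CountablyGenerated X] [MeasureSpace Y] [SigmaFinite (volume : Measure Y)]
    {Ω : Set X} {I : Set Y} (hI : MeasurableSet I) (hIfin : volume I ≠ ⊤)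
    {a : X → Y → ℂ} {g : X → ℝ} {K : X → X → ℂ} {κ : Y → Y → ℂ}
    (ha : Measurable (Function.uncurry a)) (hg : MemLp g 2 (volume.restrict Ω))
    (hg0 : ∀ x, 0 ≤ g x) (hag : ∀ x, ∀ y ∈ I, ‖a x y‖ ≤ g x)
    (hK : ∀ x x', K x x' = ∫ y in I, a x y * conj (a x' y))
    (hκ : ∀ y ∈ I, ∀ y' ∈ I, ∫ x in Ω, conj (a x y) * a x y' = κ y y')
    (hsq : SqIntegrableKernel K Ω) :
    FredholmConverges K Ω ∧ EigenSummable (integralOp K Ω hsq) ∧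
      eigenProd (integralOp K Ω hsq) = fredholmSeries κ I ∧
      fredholmSeries K Ω = fredholmSeries κ I := by
  have hfin : IsFiniteMeasure (volume.restrict I) := ⟨by simpa using hIfin.lt_top⟩
  -- The bound by g holds only for y in I; cutting a off outside I makes it global and changes no
  -- integral over I.
  let a' : X → Y → ℂ := fun x => I.indicator (a x)
  have ha' : Measurable (Function.uncurry a') := by
    have : Function.uncurry a' = (univ ×ˢ I).indicator (Function.uncurry a) := by
      ext ⟨x, y⟩
      by_cases hy : y ∈ I <;> simp [a', hy]
    rw [this]
    exact ha.indicator (MeasurableSet.univ.prod hI)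
  have hag' : ∀ x y, ‖a' x y‖ ≤ g x := fun x y => by
    by_cases hy : y ∈ I
    · simpa [a', hy] using hag x y hy
    · simpa [a', hy] using hg0 x
  have hK' : ∀ x x', K x x' = ∫ y in I, a' x y * conj (a' x' y) := fun x x' => by
    rw [hK]
    refine setIntegral_congr_fun hI fun y hy => ?_
    simp [a', hy]
  have hκ' : ∀ y ∈ I, ∀ y' ∈ I, ∫ x in Ω, conj (a' x y) * a' x y' = κ y y' := fun y hy y' hy' => by
    rw [← hκ y hy y' hy']
    simp [a', hy, hy']
  have hκn : ∀ y y', ‖∫ x in Ω, conj (a' x y) * a' x y'‖ ≤ ∫ x in Ω, g x ^ 2 := fun y y' => by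
    refine norm_integral_le_of_norm_le hg.integrable_sq (Eventually.of_forall fun x => ?_)
    rw [norm_mul, RCLike.norm_conj, sq]
    exact mul_le_mul (hag' _ _) (hag' _ _) (norm_nonneg _) (hg0 x)
  have hterm : ∀ l, fredholmTerm (fun y y' => ∫ x in Ω, conj (a' x y) * a' x y') I l =
      fredholmTerm κ I l := fun l => fredholmTerm_congr hI hκ' l
  have hKterm : ∀ l, fredholmTerm K Ω l = fredholmTerm κ I l := fun l => by
    rw [← hterm, fredholmTerm_eq, fredholmTerm_eq]
    simp only [hK']
    rw [integral_det_eq_integral_det ha' hg hag']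
  -- Hadamard's bound is used on the side of κ, where I has finite measure. Ω may have infinite
  -- measure, so K inherits its convergence through `hKterm`.
  have hsum : Summable fun l => ‖fredholmTerm κ I l‖ := by
    refine (summable_sqrt_mul_pow_div_factorial ((∫ x in Ω, g x ^ 2) * volume.real I)).of_nonneg_of_le
      (fun _ => norm_nonneg _) fun l => ?_
    rw [← hterm]
    exact norm_fredholmTerm_le hIfin hκn l
  obtain ⟨h1, h2⟩ := integralOp_eigenSummable_and_eigenProd_eq ha' hg hag' hK' hsq
  refine ⟨⟨fun l => ?_, ?_⟩, h1, ?_, ?_⟩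
  · rw [IntegrableOn, volume_pi, Measure.restrict_pi_pi]
    unfold corrDet
    simp only [hK']
    exact integrable_det_left ha' hg hag' l
  · simp only [hKterm]
    exact (summable_nat_add_iff 1).2 hsum
  · rw [h2, fredholmSeries_eq_tsum hsum.of_norm]
    simp only [← hterm, fredholmTerm_eq]
  · simp only [fredholmSeries, hKterm]

end Series

/-! ### Continuity and analyticity of Fredholm series in parameters. -/

section Analytic

/-- Cauchy's estimate on unit circles bounds the t-derivative by the maximum of |f| on a compact
set. The radius 2 there is 1 for the neighbourhood of t₀ plus 1 for the circle. -/
theorem differentiable_setIntegral_of_continuous {Y : Type*} [TopologicalSpace Y]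
    [SecondCountableTopology Y] [MeasurableSpace Y] [BorelSpace Y] {μ : Measure Y}
    [IsLocallyFiniteMeasure μ] {f : ℂ → Y → ℂ} (hf : Continuous (Function.uncurry f))
    (hd : ∀ y, Differentiable ℂ fun t => f t y) {s : Set Y} (hs : IsCompact s)
    (hsm : MeasurableSet s) :
    Differentiable ℂ fun t => ∫ y in s, f t y ∂μ := by
  intro t₀
  obtain ⟨M, hM⟩ := (((isCompact_closedBall t₀ 2).prod hs).image hf).isBounded.exists_norm_le
  have hfin : IsFiniteMeasure (μ.restrict s) := ⟨by simpa using hs.measure_lt_top⟩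
  have hft : ∀ t, Continuous (f t) := fun t => by
    have h : Continuous fun y : Y => (t, y) := by fun_prop
    exact hf.comp h
  have hft0 : AEStronglyMeasurable (fun y => deriv (fun t => f t y) t₀) (μ.restrict s) := by
    have h := stronglyMeasurable_deriv_with_param (𝕜 := ℂ) (f := fun (y : Y) (t : ℂ) => f t y)
      (hf.comp continuous_swap)
    exact (h.comp_measurable (measurable_id.prodMk measurable_const)).aestronglyMeasurable
  have hae : ∀ᵐ y ∂(μ.restrict s), y ∈ s := ae_restrict_mem hsm
  refine (hasDerivAt_integral_of_dominated_loc_of_deriv_le (𝕜 := ℂ) (bound := fun _ => M)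
    (F' := fun t y => deriv (fun t => f t y) t) (Metric.ball_mem_nhds t₀ one_pos)
    (Eventually.of_forall fun t => (hft t).aestronglyMeasurable) ?_ hft0 ?_
    (integrable_const _) ?_).2.differentiableAt
  · exact ((hft t₀).continuousOn.integrableOn_compact' hs hsm)
  · filter_upwards [hae] with y hy t ht
    have h := Complex.norm_deriv_le_of_forall_mem_sphere_norm_le (f := fun t => f t y) (c := t)
      (C := M) one_pos (hd y).diffContOnCl fun z hz => by
        refine hM _ ⟨(z, y), ⟨?_, hy⟩, rfl⟩
        rw [mem_sphere_iff_norm] at hz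
        rw [mem_ball_iff_norm] at ht
        rw [mem_closedBall_iff_norm]
        calc ‖z - t₀‖ = ‖(z - t) + (t - t₀)‖ := by congr 1; ring
          _ ≤ 2 := (norm_add_le _ _).trans (by linarith)
    simpa using h
  · exact Eventually.of_forall fun y t _ => (hd y t).hasDerivAt

variable {κ : ℝ → ℂ → ℝ → ℝ → ℂ} {α β : ℝ}

theorem continuous_corrDet_family
    (hκ : Continuous fun p : (ℝ × ℂ) × ℝ × ℝ => κ p.1.1 p.1.2 p.2.1 p.2.2) (l : ℕ) :
    Continuous fun p : (ℝ × ℂ) × (Fin l → ℝ) => corrDet (κ p.1.1 p.1.2) l p.2 := by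
  unfold corrDet
  refine Continuous.matrix_det (continuous_matrix fun j k => ?_)
  have h : Continuous fun p : (ℝ × ℂ) × (Fin l → ℝ) => (p.1, (p.2 j, p.2 k)) := by fun_prop
  exact hκ.comp h

/-- The boundary of the box is null; passing to the closed box gives access to compactness
arguments. -/
theorem fredholmTerm_Ioo (K : ℝ → ℝ → ℂ) (l : ℕ) :
    fredholmTerm K (Ioo α β) l = (-1) ^ l / (Nat.factorial l : ℂ) *
      ∫ x in Icc (fun _ : Fin l => α) (fun _ => β), corrDet K l x := by
  rw [fredholmTerm, volume_pi]
  congr 1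
  exact setIntegral_congr_set Measure.univ_pi_Ioo_ae_eq_Icc

theorem continuous_fredholmTerm_family
    (hκ : Continuous fun p : (ℝ × ℂ) × ℝ × ℝ => κ p.1.1 p.1.2 p.2.1 p.2.2) (l : ℕ) :
    Continuous fun p : ℝ × ℂ => fredholmTerm (κ p.1 p.2) (Ioo α β) l := by
  simp only [fredholmTerm_Ioo]
  exact continuous_const.mul (continuous_parametric_integral_of_continuous
    (f := fun p : ℝ × ℂ => corrDet (κ p.1 p.2) l) (continuous_corrDet_family hκ l) isCompact_Icc)

theorem differentiable_fredholmTerm_family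
    (hκ : Continuous fun p : (ℝ × ℂ) × ℝ × ℝ => κ p.1.1 p.1.2 p.2.1 p.2.2)
    (hd : ∀ σ v w, Differentiable ℂ fun t => κ σ t v w) (σ : ℝ) (l : ℕ) :
    Differentiable ℂ fun t => fredholmTerm (κ σ t) (Ioo α β) l := by
  simp only [fredholmTerm_Ioo]
  refine Differentiable.const_mul (differentiable_setIntegral_of_continuous ?_ (fun x => ?_)
    isCompact_Icc measurableSet_Icc) _
  · have h : Continuous fun p : ℂ × (Fin l → ℝ) => ((σ, p.1), p.2) := by fun_prop
    exact (continuous_corrDet_family hκ l).comp h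
  · unfold corrDet
    simp only [Matrix.det_apply', Matrix.of_apply]
    exact Differentiable.fun_sum fun π _ => (Differentiable.const_mul
      (Differentiable.fun_finsetProd fun j _ => hd σ _ _) _)

/-- The majorant for the Weierstrass M-test, locally uniform in both parameters. -/
theorem exists_summable_bound_fredholmTerm
    (hκ : Continuous fun p : (ℝ × ℂ) × ℝ × ℝ => κ p.1.1 p.1.2 p.2.1 p.2.2) (R : ℝ) :
    ∃ u : ℕ → ℝ, Summable u ∧ ∀ l, ∀ p ∈ Metric.closedBall (0 : ℝ × ℂ) R,
      ‖fredholmTerm (κ p.1 p.2) (Ioo α β) l‖ ≤ u l := by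
  obtain ⟨M, hM⟩ := (((isCompact_closedBall (0 : ℝ × ℂ) R).prod
    ((isCompact_Icc (a := α) (b := β)).prod (isCompact_Icc (a := α) (b := β)))).image
      hκ).isBounded.exists_norm_le
  refine ⟨_, summable_sqrt_mul_pow_div_factorial (max M 0 * volume.real (Ioo α β)),
    fun l p hp => ?_⟩
  -- `norm_fredholmTerm_le` needs a bound at all points, so the kernel is cut off outside the square
  -- on which compactness provides one.
  rw [fredholmTerm_congr (K' := fun v w => (Ioo α β ×ˢ Ioo α β).indicator
    (fun q : ℝ × ℝ => κ p.1 p.2 q.1 q.2) (v, w)) measurableSet_Ioo fun v hv w hw => by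
      simp [hv.1, hv.2, hw.1, hw.2]]
  refine norm_fredholmTerm_le (by simp) (fun v w => ?_) l
  by_cases h : (v, w) ∈ Ioo α β ×ˢ Ioo α β
  · rw [indicator_of_mem h]
    exact (hM _ ⟨(p, v, w), ⟨hp, Ioo_subset_Icc_self h.1, Ioo_subset_Icc_self h.2⟩, rfl⟩).trans
      (le_max_left _ _)
  · rw [indicator_of_notMem h, norm_zero]
    exact le_max_right _ _

theorem summable_fredholmTerm_family
    (hκ : Continuous fun p : (ℝ × ℂ) × ℝ × ℝ => κ p.1.1 p.1.2 p.2.1 p.2.2) (σ : ℝ) (t : ℂ) :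
    Summable (fredholmTerm (κ σ t) (Ioo α β)) := by
  obtain ⟨u, hu, hle⟩ := exists_summable_bound_fredholmTerm (α := α) (β := β) hκ ‖(σ, t)‖
  exact hu.of_norm_bounded fun l => hle l (σ, t) (by simp)

theorem continuous_fredholmSeries_family
    (hκ : Continuous fun p : (ℝ × ℂ) × ℝ × ℝ => κ p.1.1 p.1.2 p.2.1 p.2.2) :
    Continuous fun p : ℝ × ℂ => fredholmSeries (κ p.1 p.2) (Ioo α β) := by
  simp only [fredholmSeries_eq_tsum (summable_fredholmTerm_family hκ _ _)]
  rw [continuous_iff_continuousAt]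
  intro p
  obtain ⟨u, hu, hle⟩ := exists_summable_bound_fredholmTerm (α := α) (β := β) hκ (‖p‖ + 1)
  refine (continuousOn_tsum (fun l => (continuous_fredholmTerm_family hκ l).continuousOn) hu
    hle).continuousAt ?_
  refine mem_of_superset (Metric.ball_mem_nhds p one_pos) fun q hq => ?_
  rw [mem_ball_iff_norm] at hq
  rw [mem_closedBall_zero_iff]
  calc ‖q‖ = ‖p + (q - p)‖ := by congr 1; abel
    _ ≤ ‖p‖ + 1 := (norm_add_le _ _).trans (by linarith)

theorem differentiable_fredholmSeries_family
    (hκ : Continuous fun p : (ℝ × ℂ) × ℝ × ℝ => κ p.1.1 p.1.2 p.2.1 p.2.2)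
    (hd : ∀ σ v w, Differentiable ℂ fun t => κ σ t v w) (σ : ℝ) :
    Differentiable ℂ fun t => fredholmSeries (κ σ t) (Ioo α β) := by
  simp only [fredholmSeries_eq_tsum (summable_fredholmTerm_family hκ _ _)]
  intro t
  obtain ⟨u, hu, hle⟩ := exists_summable_bound_fredholmTerm (α := α) (β := β) hκ
    (max |σ| (‖t‖ + 1))
  have h := Complex.differentiableOn_tsum_of_summable_norm hu (U := Metric.ball t 1)
    (fun l => (differentiable_fredholmTerm_family hκ hd σ l).differentiableOn) Metric.isOpen_ball
    fun l s hs => hle l (σ, s) (by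
      rw [mem_closedBall_zero_iff, Prod.norm_mk]
      refine max_le_max le_rfl ?_
      rw [mem_ball_iff_norm] at hs
      calc ‖s‖ = ‖t + (s - t)‖ := by congr 1; abel
        _ ≤ ‖t‖ + 1 := (norm_add_le _ _).trans (by linarith))
  exact (h t (Metric.mem_ball_self one_pos)).differentiableAt (Metric.ball_mem_nhds t one_pos)

/-- Derivatives of a jointly continuous family of entire functions are continuous in the
parameter. -/
theorem tendsto_deriv_of_continuous_family {D : ℝ → ℂ → ℂ}
    (hc : Continuous fun p : ℝ × ℂ => D p.1 p.2) (hd : ∀ σ, Differentiable ℂ (D σ)) (σ₀ : ℝ)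
    (t : ℂ) : Tendsto (fun σ => deriv (D σ) t) (𝓝 σ₀) (𝓝 (deriv (D σ₀) t)) := by
  -- Currying turns joint continuity into continuity for the compact-open topology, that is, locally
  -- uniform convergence; for holomorphic functions this passes to derivatives.
  let Φ : C(ℝ, C(ℂ, ℂ)) := ContinuousMap.curry ⟨fun p : ℝ × ℂ => D p.1 p.2, hc⟩
  have h1 := ContinuousMap.tendsto_iff_tendstoLocallyUniformly.1 (Φ.continuous.tendsto σ₀)
  have h2 : TendstoLocallyUniformlyOn D (D σ₀) (𝓝 σ₀) univ :=
    tendstoLocallyUniformlyOn_univ.2 h1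
  exact (h2.deriv (Eventually.of_forall fun σ => (hd σ).differentiableOn) isOpen_univ).tendsto_at
    (mem_univ t)

end Analytic

/-! ### Factorization of the two kernels and the common dual kernel. -/

section DualKernel

open scoped ComplexConjugate

/-- The kernel `exp(-σ²(v-w)²/4) (2π)⁻¹ ∫_α^t exp(i(w-v)x) dx`, continued analytically in `t`. -/
noncomputable def dualKernel (α σ : ℝ) (t : ℂ) (v w : ℝ) : ℂ :=
  ((Real.exp (-(σ ^ 2 * (v - w) ^ 2 / 4)) : ℝ) : ℂ) * ((t - α) / (2 * Real.pi) *
    (Complex.exp (Complex.I * (w - v) * α) *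
      dslope Complex.exp 0 (Complex.I * (w - v) * (t - α))))

theorem differentiable_dslope_exp : Differentiable ℂ (dslope Complex.exp 0) :=
  differentiableOn_univ.1 ((Complex.differentiableOn_dslope univ_mem).2
    Complex.differentiable_exp.differentiableOn)

theorem continuous_dualKernel (α : ℝ) :
    Continuous fun p : (ℝ × ℂ) × ℝ × ℝ => dualKernel α p.1.1 p.1.2 p.2.1 p.2.2 := by
  unfold dualKernel
  refine Continuous.mul (by fun_prop) (Continuous.mul (by fun_prop) (Continuous.mul (by fun_prop) ?_))
  exact differentiable_dslope_exp.continuous.comp (by fun_prop)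

theorem differentiable_dualKernel (α σ v w : ℝ) :
    Differentiable ℂ fun t => dualKernel α σ t v w := by
  unfold dualKernel
  refine Differentiable.const_mul (Differentiable.mul (by fun_prop) (Differentiable.const_mul ?_ _)) _
  exact differentiable_dslope_exp.comp (by fun_prop)

/-- `dslope Complex.exp 0` is the entire function (e^z - 1)/z with value 1 at 0. It covers c = 0,
hence v = w, and lets the endpoint become complex. -/
theorem integral_cexp_mul_eq_dslope (c : ℂ) (α β : ℝ) :
    ∫ x in α..β, Complex.exp (c * x) =
      ((β : ℂ) - α) * (Complex.exp (c * α) * dslope Complex.exp 0 (c * (β - α))) := by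
  by_cases hc : c = 0
  · simp [hc]
  rw [integral_exp_mul_complex hc]
  by_cases h : (β : ℂ) - α = 0
  · rw [sub_eq_zero] at h
    simp [h]
  · rw [dslope_of_ne _ (mul_ne_zero hc h), slope_def_field, Complex.exp_zero, sub_zero, mul_sub,
      Complex.exp_sub]
    have : Complex.exp (c * α) ≠ 0 := Complex.exp_ne_zero _
    have h2 : c * β - c * α ≠ 0 := by rw [← mul_sub]; exact mul_ne_zero hc h
    field_simp

theorem dualKernel_eq_integral (α β σ v w : ℝ) :
    dualKernel α σ β v w = ((Real.exp (-(σ ^ 2 * (v - w) ^ 2 / 4)) : ℝ) : ℂ) *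
      (1 / (2 * Real.pi) * ∫ x in α..β, Complex.exp (Complex.I * (w - v) * x)) := by
  rw [dualKernel, integral_cexp_mul_eq_dslope]
  ring

theorem conj_cexp_I_mul (v : ℝ) (z : ℂ) :
    conj (Complex.exp (Complex.I * v * z)) = Complex.exp (-(Complex.I * v * conj z)) := by
  rw [← Complex.exp_conj]
  simp

/-- The sine kernel is the Fourier transform of the indicator of (-π, π), which exhibits it as A A*
with a x v = exp(ivx)/√(2π). -/
theorem sineKernel_eq_integral (x x' : ℝ) :
    sineKernel x x' = 1 / (2 * Real.pi) *
      ∫ v in (-Real.pi)..Real.pi, Complex.exp (Complex.I * v * (x - x')) := by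
  have hpi : (Real.pi : ℂ) ≠ 0 := by exact_mod_cast Real.pi_ne_zero
  by_cases h : x - x' = 0
  · have h' : (x : ℂ) - x' = 0 := by exact_mod_cast h
    rw [sineKernel, h, h']
    simp
    field_simp
    norm_num
  · have h' : (x : ℂ) - x' ≠ 0 := by exact_mod_cast h
    have hc : Complex.I * ((x : ℂ) - x') ≠ 0 := mul_ne_zero Complex.I_ne_zero h'
    have h1 : ∫ v in (-Real.pi)..Real.pi, Complex.exp (Complex.I * v * (x - x')) =
        ∫ v in (-Real.pi)..Real.pi, Complex.exp (Complex.I * (x - x') * v) := by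
      refine intervalIntegral.integral_congr fun v _ => ?_
      congr 1
      ring
    rw [h1, integral_exp_mul_complex hc, sineKernel, Real.sinc_of_ne_zero (by positivity)]
    push_cast
    rw [Complex.sin]
    have e1 : -(Real.pi * ((x : ℂ) - x')) * Complex.I = Complex.I * (x - x') * -Real.pi := by ring
    have e2 : (Real.pi * ((x : ℂ) - x')) * Complex.I = Complex.I * (x - x') * Real.pi := by ring
    rw [e1, e2]
    field_simp
    rw [Complex.I_sq]
    ring

theorem fredholm_sineKernel {α β : ℝ} (hαβ : α ≤ β)
    (hsq : SqIntegrableKernel sineKernel (Ioo α β)) :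
    FredholmConverges sineKernel (Ioo α β) ∧ EigenSummable (integralOp sineKernel (Ioo α β) hsq) ∧
      eigenProd (integralOp sineKernel (Ioo α β) hsq) =
        fredholmSeries (dualKernel α 0 β) (Ioo (-Real.pi) Real.pi) ∧
      fredholmSeries sineKernel (Ioo α β) =
        fredholmSeries (dualKernel α 0 β) (Ioo (-Real.pi) Real.pi) := by
  have hpi := Real.pi_pos
  set c : ℝ := Real.sqrt (1 / (2 * Real.pi)) with hc
  have hcc : (c : ℂ) * c = 1 / (2 * Real.pi) := by
    rw [← Complex.ofReal_mul, hc, Real.mul_self_sqrt (by positivity)]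
    push_cast
    rfl
  refine fredholm_factor (a := fun (x : ℝ) (v : ℝ) => (c : ℂ) * Complex.exp (Complex.I * v * x))
    (g := fun _ => c) measurableSet_Ioo (by simp) ?_ (memLp_const c) (fun _ => Real.sqrt_nonneg _)
    ?_ ?_ ?_ hsq
  · exact Continuous.measurable (by unfold Function.uncurry; fun_prop)
  · intro x v _
    rw [norm_mul, Complex.norm_exp, Complex.norm_real, Real.norm_of_nonneg (Real.sqrt_nonneg _)]
    have h : (Complex.I * v * x).re = 0 := by simp
    rw [h, Real.exp_zero, mul_one]
  · intro x x'
    rw [sineKernel_eq_integral, ← intervalIntegral.integral_const_mul,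
      intervalIntegral.integral_of_le (by linarith), integral_Ioc_eq_integral_Ioo]
    refine setIntegral_congr_fun measurableSet_Ioo fun v _ => ?_
    simp only [map_mul, conj_cexp_I_mul, Complex.conj_ofReal]
    rw [mul_mul_mul_comm, hcc, ← Complex.exp_add]
    congr 2
    ring
  · intro v _ w _
    rw [dualKernel_eq_integral, ← intervalIntegral.integral_const_mul,
      ← intervalIntegral.integral_const_mul,
      intervalIntegral.integral_of_le hαβ, integral_Ioc_eq_integral_Ioo]
    refine setIntegral_congr_fun measurableSet_Ioo fun x _ => ?_
    simp only [map_mul, conj_cexp_I_mul, Complex.conj_ofReal]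
    rw [mul_mul_mul_comm, hcc, ← Complex.exp_add]
    simp only [zero_pow two_ne_zero, zero_mul, zero_div, neg_zero, Real.exp_zero,
      Complex.ofReal_one, one_mul]
    congr 2
    ring

/-- Unlike the cosine, the exponential of iu(z₁ - z̄₂) splits into a function of z₁ times the
conjugate of the same function of z₂. -/
theorem integral_even_mul_cos {h : ℝ → ℂ} (hh : Continuous h) (he : ∀ u, h (-u) = h u) (w : ℂ)
    (a : ℝ) :
    ∫ u in (-a)..a, h u * Complex.cos (u * w) =
      ∫ u in (-a)..a, h u * Complex.exp (Complex.I * u * w) := by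
  have h1 : ∫ u in (-a)..a, h u * Complex.exp (-(Complex.I * u * w)) =
      ∫ u in (-a)..a, h u * Complex.exp (Complex.I * u * w) := by
    have := intervalIntegral.integral_comp_neg (a := -a) (b := a)
      fun u : ℝ => h u * Complex.exp (Complex.I * u * w)
    rw [neg_neg] at this
    rw [← this]
    refine intervalIntegral.integral_congr fun u _ => ?_
    simp only [he]
    congr 2
    push_cast
    ring
  have h2 : ∀ u : ℝ, h u * Complex.cos (u * w) = 1 / 2 *
      (h u * Complex.exp (Complex.I * u * w) + h u * Complex.exp (-(Complex.I * u * w))) := by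
    intro u
    rw [Complex.cos]
    have e1 : (u * w) * Complex.I = Complex.I * u * w := by ring
    rw [neg_mul, e1]
    ring
  simp only [h2]
  rw [intervalIntegral.integral_const_mul, intervalIntegral.integral_add
    (Continuous.intervalIntegrable (by fun_prop) _ _)
    (Continuous.intervalIntegrable (by fun_prop) _ _), h1]
  ring

theorem weakKernel_eq_integral (σ : ℝ) (z₁ z₂ : ℂ) :
    weakKernel σ z₁ z₂ =
      ((1 / (σ * Real.sqrt Real.pi) *
        Real.exp (-((z₁.im ^ 2 + z₂.im ^ 2) / (2 * σ ^ 2))) : ℝ) : ℂ) *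
      (1 / (2 * (Real.pi : ℂ)) * ∫ u in (-Real.pi)..Real.pi, ((Real.exp (-(σ * u) ^ 2) : ℝ) : ℂ) *
        Complex.exp (Complex.I * u * (z₁ - conj z₂))) := by
  rw [weakKernel, integral_even_mul_cos (h := fun u => ((Real.exp (-(σ * u) ^ 2) : ℝ) : ℂ))
    (by fun_prop) (fun u => by simp)]

/-- Completing the square; with s = v + w this is the integral over the imaginary part in A* A. -/
theorem integral_gaussian_linear {σ : ℝ} (hσ : 0 < σ) (s : ℝ) :
    ∫ y : ℝ, Real.exp (-(y ^ 2 / σ ^ 2) - s * y) =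
      σ * Real.sqrt Real.pi * Real.exp (σ ^ 2 * s ^ 2 / 4) := by
  have h1 : ∀ y : ℝ, Real.exp (-(y ^ 2 / σ ^ 2) - s * y) =
      Real.exp (-(1 / σ ^ 2) * (y + σ ^ 2 * s / 2) ^ 2) * Real.exp (σ ^ 2 * s ^ 2 / 4) := by
    intro y
    rw [← Real.exp_add]
    congr 1
    field_simp
    ring
  simp only [h1]
  rw [integral_mul_const,
    integral_add_right_eq_self (fun y => Real.exp (-(1 / σ ^ 2) * y ^ 2)), integral_gaussian,
    one_div, div_inv_eq_mul, Real.sqrt_mul Real.pi_pos.le, Real.sqrt_sq hσ.le]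
  ring

theorem integral_strip_mul (α β : ℝ) (f h : ℝ → ℂ) :
    ∫ z in strip α β, f z.re * h z.im = (∫ x in Ioo α β, f x) * ∫ y, h y := by
  have e : strip α β = Complex.measurableEquivRealProd ⁻¹' (Ioo α β ×ˢ univ) := by
    ext z
    simp [strip, Complex.measurableEquivRealProd_apply]
  have h1 := Complex.volume_preserving_equiv_real_prod.setIntegral_preimage_emb
    Complex.measurableEquivRealProd.measurableEmbedding (fun p : ℝ × ℝ => f p.1 * h p.2)
    (Ioo α β ×ˢ univ)
  rw [← e] at h1
  simp only [Complex.measurableEquivRealProd_apply] at h1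
  rw [h1, Measure.volume_eq_prod, setIntegral_prod_mul, Measure.restrict_univ]

/-- The growth exp(π|y|) of exp(ivz) costs half of the decay exp(-y²/(2σ²)) and leaves
exp(-y²/(4σ²)). -/
theorem pi_mul_abs_le {σ : ℝ} (hσ : 0 < σ) (y : ℝ) :
    Real.pi * |y| ≤ y ^ 2 / (4 * σ ^ 2) + (Real.pi * σ) ^ 2 := by
  have h := sq_nonneg (|y| / (2 * σ) - Real.pi * σ)
  have e : (|y| / (2 * σ) - Real.pi * σ) ^ 2 =
      y ^ 2 / (4 * σ ^ 2) + (Real.pi * σ) ^ 2 - Real.pi * |y| := by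
    rw [← sq_abs y]
    field_simp
    ring
  linarith

theorem fredholm_weakKernel {σ : ℝ} (hσ : 0 < σ) {α β : ℝ} (hαβ : α ≤ β)
    (hsq : SqIntegrableKernel (weakKernel σ) (strip α β)) :
    FredholmConverges (weakKernel σ) (strip α β) ∧
      EigenSummable (integralOp (weakKernel σ) (strip α β) hsq) ∧
      eigenProd (integralOp (weakKernel σ) (strip α β) hsq) =
        fredholmSeries (dualKernel α σ β) (Ioo (-Real.pi) Real.pi) ∧
      fredholmSeries (weakKernel σ) (strip α β) =
        fredholmSeries (dualKernel α σ β) (Ioo (-Real.pi) Real.pi) := by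
  have hpi := Real.pi_pos
  have hspi : 0 < Real.sqrt Real.pi := Real.sqrt_pos.2 hpi
  -- Each copy of a carries the square root of the two normalizing constants of the weak kernel.
  set c : ℝ := Real.sqrt (1 / (σ * Real.sqrt Real.pi) * (1 / (2 * Real.pi))) with hc
  have hc0 : 0 ≤ c := Real.sqrt_nonneg _
  have hcc : c * c = 1 / (σ * Real.sqrt Real.pi) * (1 / (2 * Real.pi)) :=
    Real.mul_self_sqrt (by positivity)
  let r : ℝ → ℝ → ℝ := fun y v => c * Real.exp (-(y ^ 2 / (2 * σ ^ 2)) - (σ * v) ^ 2 / 2)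
  have hr0 : ∀ y v, 0 ≤ r y v := fun y v => by positivity
  refine fredholm_factor (a := fun (z : ℂ) (v : ℝ) => (r z.im v : ℂ) * Complex.exp (Complex.I * v * z))
    (g := fun z => c * Real.exp ((Real.pi * σ) ^ 2) * Real.exp (-(1 / (4 * σ ^ 2)) * z.im ^ 2))
    measurableSet_Ioo (by simp) ?_ ?_ (fun _ => by positivity) ?_ ?_ ?_ hsq
  · refine Continuous.measurable ?_
    simp only [r]
    unfold Function.uncurry
    fun_prop
  · refine (memLp_two_iff_integrable_sq (Continuous.aestronglyMeasurable (by fun_prop))).2 ?_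
    have h1 := (integrable_gauss_strip (c := 1 / (2 * σ ^ 2)) (by positivity) α β).const_mul
      ((c * Real.exp ((Real.pi * σ) ^ 2)) ^ 2)
    refine h1.congr (Eventually.of_forall fun z => ?_)
    simp only
    rw [mul_pow _ (Real.exp (-(1 / (4 * σ ^ 2)) * z.im ^ 2)), ← Real.exp_nat_mul]
    congr 2
    push_cast
    field_simp
    ring
  · intro z v hv
    rw [norm_mul, Complex.norm_exp, Complex.norm_real, Real.norm_of_nonneg (hr0 _ _), mul_assoc c,
      mul_assoc c, ← Real.exp_add, ← Real.exp_add]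
    refine mul_le_mul_of_nonneg_left (Real.exp_le_exp.2 ?_) hc0
    have h1 : (Complex.I * v * z).re = -(v * z.im) := by simp
    have h2 : |v * z.im| ≤ Real.pi * |z.im| := by
      rw [abs_mul]
      exact mul_le_mul_of_nonneg_right (abs_le.2 ⟨hv.1.le, hv.2.le⟩) (abs_nonneg _)
    have h3 := pi_mul_abs_le hσ z.im
    have h4 := neg_le_abs (v * z.im)
    have h5 : z.im ^ 2 / (2 * σ ^ 2) = z.im ^ 2 / (4 * σ ^ 2) + z.im ^ 2 / (4 * σ ^ 2) := by
      field_simp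
      ring
    have h6 : -(1 / (4 * σ ^ 2)) * z.im ^ 2 = -(z.im ^ 2 / (4 * σ ^ 2)) := by ring
    have h7 := sq_nonneg (σ * v)
    rw [h1, h5, h6]
    linarith
  · intro z z'
    rw [weakKernel_eq_integral, ← intervalIntegral.integral_const_mul,
      ← intervalIntegral.integral_const_mul,
      intervalIntegral.integral_of_le (by linarith), integral_Ioc_eq_integral_Ioo]
    refine setIntegral_congr_fun measurableSet_Ioo fun v _ => ?_
    simp only [map_mul, conj_cexp_I_mul, Complex.conj_ofReal]
    rw [mul_mul_mul_comm, ← Complex.exp_add]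
    have h1 : r z.im v * r z'.im v = (1 / (σ * Real.sqrt Real.pi) *
        Real.exp (-((z.im ^ 2 + z'.im ^ 2) / (2 * σ ^ 2)))) * (1 / (2 * Real.pi)) *
        Real.exp (-(σ * v) ^ 2) := by
      simp only [r]
      rw [mul_mul_mul_comm, hcc, ← Real.exp_add]
      have : Real.exp (-(z.im ^ 2 / (2 * σ ^ 2)) - (σ * v) ^ 2 / 2 +
          (-(z'.im ^ 2 / (2 * σ ^ 2)) - (σ * v) ^ 2 / 2)) =
          Real.exp (-((z.im ^ 2 + z'.im ^ 2) / (2 * σ ^ 2))) * Real.exp (-(σ * v) ^ 2) := by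
        rw [← Real.exp_add]
        congr 1
        ring
      rw [this]
      ring
    rw [← Complex.ofReal_mul, h1]
    have h2 : Complex.I * v * z + -(Complex.I * v * conj z') = Complex.I * v * (z - conj z') := by
      ring
    rw [h2]
    push_cast
    ring
  · intro v _ w _
    -- The integrand separates: Re z enters through an oscillation of frequency w - v, Im z through
    -- a real Gaussian with linear term -(v + w)y.
    have h1 : ∀ z : ℂ, conj ((r z.im v : ℂ) * Complex.exp (Complex.I * v * z)) *
        ((r z.im w : ℂ) * Complex.exp (Complex.I * w * z)) =
        Complex.exp (Complex.I * (w - v) * z.re) *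
          ((c * c * Real.exp (-(σ ^ 2 * (v ^ 2 + w ^ 2) / 2)) *
            Real.exp (-(z.im ^ 2 / σ ^ 2) - (v + w) * z.im) : ℝ) : ℂ) := by
      intro z
      simp only [map_mul, conj_cexp_I_mul, Complex.conj_ofReal, r]
      push_cast
      rw [mul_mul_mul_comm, mul_mul_mul_comm (c : ℂ), mul_assoc (c * c : ℂ), ← Complex.exp_add,
        ← Complex.exp_add, ← Complex.exp_add, mul_comm (Complex.exp (Complex.I * (w - v) * z.re)),
        mul_assoc (c * c : ℂ), mul_assoc (c * c : ℂ), ← Complex.exp_add, ← Complex.exp_add]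
      congr 2
      have hz : conj z = z.re - z.im * Complex.I := by
        apply Complex.ext <;> simp
      have hz' : Complex.I * w * z = Complex.I * w * (z.re + z.im * Complex.I) := by
        rw [Complex.re_add_im]
      rw [hz, hz']
      have hσ' : (σ : ℂ) ≠ 0 := by exact_mod_cast hσ.ne'
      field_simp
      ring_nf
      rw [Complex.I_sq]
      ring
    simp only [h1]
    rw [integral_strip_mul α β (fun x => Complex.exp (Complex.I * (w - v) * x))
      (fun y => ((c * c * Real.exp (-(σ ^ 2 * (v ^ 2 + w ^ 2) / 2)) *
            Real.exp (-(y ^ 2 / σ ^ 2) - (v + w) * y) : ℝ) : ℂ)),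
      integral_complex_ofReal, integral_const_mul, integral_gaussian_linear hσ, hcc,
      dualKernel_eq_integral, intervalIntegral.integral_of_le hαβ, integral_Ioc_eq_integral_Ioo]
    -- The y-integral cancels 1/(σ√π), and -(v² + w²)/2 + (v + w)²/4 = -(v - w)²/4; nothing singular
    -- in σ remains.
    have h2 : 1 / (σ * Real.sqrt Real.pi) * (1 / (2 * Real.pi)) *
        Real.exp (-(σ ^ 2 * (v ^ 2 + w ^ 2) / 2)) *
        (σ * Real.sqrt Real.pi * Real.exp (σ ^ 2 * (v + w) ^ 2 / 4)) =
        1 / (2 * Real.pi) * Real.exp (-(σ ^ 2 * (v - w) ^ 2 / 4)) := by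
      have : Real.exp (-(σ ^ 2 * (v - w) ^ 2 / 4)) =
          Real.exp (-(σ ^ 2 * (v ^ 2 + w ^ 2) / 2)) * Real.exp (σ ^ 2 * (v + w) ^ 2 / 4) := by
        rw [← Real.exp_add]
        congr 1
        ring
      rw [this]
      field_simp
    rw [h2]
    push_cast
    ring

end DualKernel

/-! ### Spacing distributions and the limit σ ↓ 0. -/

section Spacing

variable {D : ℂ → ℂ} {f : ℝ → ℂ}

theorem iteratedDeriv_two_ofReal_eq (hD : Differentiable ℂ D) (hf : ∀ u : ℝ, 0 < u → f u = D u)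
    {u : ℝ} (hu : 0 < u) : iteratedDeriv 2 f u = deriv (deriv D) u := by
  have h1 : ∀ u : ℝ, 0 < u → deriv f u = deriv D u := fun u hu => by
    refine HasDerivAt.deriv ((hD u).hasDerivAt.comp_ofReal.congr_of_eventuallyEq ?_)
    filter_upwards [Ioi_mem_nhds hu] with v hv using hf v hv
  rw [iteratedDeriv_succ, iteratedDeriv_one]
  refine HasDerivAt.deriv ((hD.deriv u).hasDerivAt.comp_ofReal.congr_of_eventuallyEq ?_)
  filter_upwards [Ioi_mem_nhds hu] with v hv using h1 v hv

theorem spacingWellDefined_of_differentiable (hD : Differentiable ℂ D)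
    (hf : ∀ u : ℝ, 0 < u → f u = D u) : SpacingWellDefined f := by
  constructor
  · have h : ContDiff ℝ 2 fun u : ℝ => D u :=
      (hD.contDiff.restrict_scalars ℝ).comp Complex.ofRealCLM.contDiff
    exact h.contDiffOn.congr fun u hu => hf u hu
  · intro s hs
    have h : IntervalIntegrable (fun u : ℝ => deriv (deriv D) u) volume 0 s :=
      (hD.deriv.deriv.continuous.comp Complex.continuous_ofReal).intervalIntegrable _ _
    refine h.congr fun u hu => ?_
    rw [uIoc_of_le hs.le] at hu
    exact (iteratedDeriv_two_ofReal_eq hD hf hu.1).symm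

/-- Since D is entire, the fundamental theorem of calculus reaches the endpoint 0 although f equals
D only for u > 0. Convergence of two first derivatives then suffices for `tendsto_wp`. -/
theorem spacing_eq_sub (hD : Differentiable ℂ D) (hf : ∀ u : ℝ, 0 < u → f u = D u) {s : ℝ}
    (hs : 0 < s) : spacing f s = deriv D s - deriv D 0 := by
  have h1 : spacing f s = ∫ u in (0 : ℝ)..s, deriv (deriv D) u := by
    refine intervalIntegral.integral_congr_ae (Eventually.of_forall fun u hu => ?_)
    rw [uIoc_of_le hs.le] at hu
    exact iteratedDeriv_two_ofReal_eq hD hf hu.1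
  rw [h1, intervalIntegral.integral_eq_sub_of_hasDerivAt (f := fun u : ℝ => deriv D u)
    (fun u _ => (hD.deriv u).hasDerivAt.comp_ofReal)
    ((hD.deriv.deriv.continuous.comp Complex.continuous_ofReal).intervalIntegrable _ _)]
  simp

theorem tendsto_of_continuous_family {D : ℝ → ℂ → ℂ}
    (hc : Continuous fun p : ℝ × ℂ => D p.1 p.2) (σ₀ : ℝ) (t : ℂ) :
    Tendsto (fun σ => D σ t) (𝓝 σ₀) (𝓝 (D σ₀ t)) := by
  have h : Continuous fun σ : ℝ => (σ, t) := by fun_prop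
  exact (hc.comp h).tendsto σ₀

theorem tendsto_fredholmSeries_dualKernel (α : ℝ) (t : ℂ) :
    Tendsto (fun σ => fredholmSeries (dualKernel α σ t) (Ioo (-Real.pi) Real.pi)) (𝓝[>] 0)
      (𝓝 (fredholmSeries (dualKernel α 0 t) (Ioo (-Real.pi) Real.pi))) :=
  (tendsto_of_continuous_family
    (D := fun σ t => fredholmSeries (dualKernel α σ t) (Ioo (-Real.pi) Real.pi))
    (continuous_fredholmSeries_family (continuous_dualKernel α)) 0 t).mono_left nhdsWithin_le_nhds

theorem differentiable_fredholmSeries_dualKernel (α σ : ℝ) :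
    Differentiable ℂ fun t => fredholmSeries (dualKernel α σ t) (Ioo (-Real.pi) Real.pi) :=
  differentiable_fredholmSeries_family (continuous_dualKernel α)
    (fun σ v w => differentiable_dualKernel α σ v w) σ

theorem eigenProd_sineOp {u : ℝ} (hu : 0 < u) :
    eigenProd (sineOp u) = fredholmSeries (dualKernel 0 0 u) (Ioo (-Real.pi) Real.pi) :=
  (fredholm_sineKernel hu.le _).2.2.1

theorem eigenProd_weakOp {σ u : ℝ} (hσ : 0 < σ) (hu : 0 < u) :
    eigenProd (weakOp σ u) = fredholmSeries (dualKernel 0 σ u) (Ioo (-Real.pi) Real.pi) :=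
  (fredholm_weakKernel hσ hu.le _).2.2.1

theorem tendsto_G {t : ℝ} (ht : 0 < t) :
    Tendsto (fun σ => G σ t) (𝓝[>] 0) (𝓝 (fredholmSeries sineKernel (Ioo (-t) t))) := by
  rw [(fredholm_sineKernel (by linarith) (sqIntegrable_sineKernel (-t) t)).2.2.2]
  refine (tendsto_fredholmSeries_dualKernel (-t) t).congr' ?_
  filter_upwards [self_mem_nhdsWithin] with σ hσ
  exact (fredholm_weakKernel hσ (by linarith) (sqIntegrable_weakKernel σ (-t) t)).2.2.2.symm

theorem tendsto_wp {s : ℝ} (hs : 0 < s) :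
    Tendsto (fun σ => wp s σ) (𝓝[>] 0) (𝓝 (gaudinMehta s)) := by
  have hd := differentiable_fredholmSeries_dualKernel 0
  have hlim := fun t : ℂ => (tendsto_deriv_of_continuous_family
    (D := fun σ t => fredholmSeries (dualKernel 0 σ t) (Ioo (-Real.pi) Real.pi))
    (continuous_fredholmSeries_family (continuous_dualKernel 0)) hd 0 t).mono_left
    (nhdsWithin_le_nhds (s := Ioi 0))
  rw [gaudinMehta, spacing_eq_sub (hd 0) (fun u hu => eigenProd_sineOp hu) hs]
  refine ((hlim s).sub (hlim 0)).congr' ?_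
  filter_upwards [self_mem_nhdsWithin] with σ hσ
  rw [wp, spacing_eq_sub (hd σ) (fun u hu => eigenProd_weakOp hσ hu) hs]

end Spacing

end SineGap

theorem corollary5p3 :
    -- all the objects below are well defined
    ((∀ t : ℝ, 0 < t →
        SineGap.FredholmConverges SineGap.sineKernel (Set.Ioo (-t) t) ∧
        SineGap.EigenSummable (SineGap.sineOp t) ∧
        ∀ σ : ℝ, 0 < σ →
          SineGap.FredholmConverges (SineGap.weakKernel σ) (SineGap.strip (-t) t) ∧
          SineGap.EigenSummable (SineGap.weakOp σ t)) ∧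
      SineGap.SpacingWellDefined (fun u => SineGap.eigenProd (SineGap.sineOp u)) ∧
      ∀ σ : ℝ, 0 < σ →
        SineGap.SpacingWellDefined (fun u => SineGap.eigenProd (SineGap.weakOp σ u))) ∧
    -- convergence of the determinants
    (∀ t : ℝ, 0 < t →
      Filter.Tendsto (fun σ : ℝ => SineGap.G σ t) (nhdsWithin 0 (Set.Ioi 0))
        (nhds (SineGap.fredholmSeries SineGap.sineKernel (Set.Ioo (-t) t)))) ∧
    -- convergence of the spacing distributions
    (∀ s : ℝ, 0 < s →
      Filter.Tendsto (fun σ : ℝ => SineGap.wp s σ) (nhdsWithin 0 (Set.Ioi 0))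
        (nhds (SineGap.gaudinMehta s))) := by
  refine ⟨⟨fun t ht => ⟨?_, ?_, fun σ hσ => ⟨?_, ?_⟩⟩, ?_, fun σ hσ => ?_⟩,
    fun t ht => SineGap.tendsto_G ht, fun s hs => SineGap.tendsto_wp hs⟩
  · exact (SineGap.fredholm_sineKernel (by linarith) (SineGap.sqIntegrable_sineKernel (-t) t)).1
  · exact (SineGap.fredholm_sineKernel ht.le _).2.1
  · exact (SineGap.fredholm_weakKernel hσ (by linarith)
      (SineGap.sqIntegrable_weakKernel σ (-t) t)).1
  · exact (SineGap.fredholm_weakKernel hσ ht.le _).2.1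
  · exact SineGap.spacingWellDefined_of_differentiable
      (SineGap.differentiable_fredholmSeries_dualKernel 0 0) fun u hu => SineGap.eigenProd_sineOp hu
  · exact SineGap.spacingWellDefined_of_differentiable
      (SineGap.differentiable_fredholmSeries_dualKernel 0 σ)
      fun u hu => SineGap.eigenProd_weakOp hσ hu
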